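/- Work over $\mathbb{C}$. Let $\mathfrak{k}$ be the (centerless) Neveu–Schwarz Lie superalgebra with even basis $L_n$ ($n\in\mathbb{Z}$), odd basis $G_r$ ($r\in\mathbb{Z}+\frac12$) and $$[L_m,L_n]=(n-m)L_{m+n},\quad [L_m,G_r]=\left(r-\tfrac m2\right)G_{m+r},\quad [G_r,G_s]=-2L_{r+s},$$ and let $\mathfrak{k}^+$ be the subalgebra spanned by the $L_n$ with $n\ge-1$ and the $G_r$ with $r\ge-\frac12$. Let $A=\mathbb{C}[t,t^{-1}]\otimes\Lambda(1)$, where $\Lambda(1)=\mathbb{C}[\xi]/(\xi^2)$ with $t$ even and $\xi$ odd, and let $A^+=\mathbb{C}[t]\otimes\Lambda(1)\subset A$. The algebra $\mathfrak{k}$ acts on $A$ by $$L_n\circ x=t^{n+1}\partial_t(x)+\tfrac12(n+1)t^n\xi\partial_\xi(x),\qquad G_{n+\frac12}\circ x=t^{n+1}\xi\partial_t(x)-t^{n+1}\partial_\xi(x)\qquad(n\in\mathbb{Z}).$$ For $(\mathfrak{g},\mathcal{A})$ equal to $(\mathfrak{k},A)$, $(\mathfrak{k}^+,A)$ or $(\mathfrak{k}^+,A^+)$,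 let $\mathfrak{g}\ltimes\mathcal{A}$ be the semidirect product, with $\mathcal{A}$ regarded as an abelian Lie superalgebra. An $\mathcal{A}\mathfrak{g}$ module is a ($\mathbb{Z}/2$-graded) $\mathfrak{g}\ltimes\mathcal{A}$ module on which $\mathcal{A}$ acts associatively, that is, as a unital associative algebra. A jet module for $(\mathfrak{g},\mathcal{A})$ is an $\mathcal{A}\mathfrak{g}$ module $M$ on which $L_0$ is diagonalizable and for which at least one nonzero weight space $M_\mu=\{v\in M\mid L_0v=\mu v\}$ is finite dimensional. A jet module is simple if it is nonzero and has no $\mathbb{Z}/2$-graded submodules besides $0$ and itself. The parity change $\Pi(M)$ of a module $M$ is the same module with even and odd parts interchanged, and $M$ is called isomorphic to $N$ up to a parity change if there is an even isomorphism from $M$ to $N$ or to $\Pi(N)$. For $\lambda,b\in\mathbb{C}$ let $\Gamma(\lambda,b)=A$, with $A$ acting by multiplication and, for $n,k\in\mathbb{Z}$, $$L_n\cdot t^k=(\lambda+k+b(n+1))t^{n+k},\qquad L_n\cdot t^k\xi=\left(\lambda+k+(n+1)\left(b+\tfrac12\right)\right)t^{n+k}\xi,$$ $$G_{n+\frac12}\cdot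 t^k=(k+\lambda+2b(n+1))t^{n+k}\xi,\qquad G_{n+\frac12}\cdot t^k\xi=-t^{n+k+1}.$$ This is an $A\mathfrak{k}$ module, hence by restriction also an $A\mathfrak{k}^+$ module and an $A^+\mathfrak{k}^+$ module. Moreover $\Gamma^+(0,b):=A^+$ is an $A^+\mathfrak{k}^+$ submodule of $\Gamma(0,b)$; put $\Gamma^-(0,b):=\Gamma(0,b)/\Gamma^+(0,b)$. Theorem. 1. Up to a parity change, every simple jet module for $(\mathfrak{k},A)$, and every simple jet module for $(\mathfrak{k}^+,A)$, is isomorphic to $\Gamma(\lambda,b)$ for some $\lambda,b\in\mathbb{C}$. 2. Up to a parity change, every simple jet module for $(\mathfrak{k}^+,A^+)$ is isomorphic to one of the following: (a) $\Gamma(\lambda,b)$ for some $\lambda\in\mathbb{C}\setminus\mathbb{Z}$ and $b\in\mathbb{C}$; (b) the submodule $\Gamma^+(0,b)=A^+$ of $\Gamma(0,b)$ for some $b\in\mathbb{C}$; (c) the quotient module $\Gamma^-(0,b)=\Gamma(0,b)/\Gamma^+(0,b)$ for some $b\in\mathbb{C}$. -/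

import Mathlib

noncomputable section

namespace NeveuSchwarz

open Module

universe u v w

/-! ### Superspaces -/

/-- A `ℤ/2`-grading of a complex vector space: `part 0` is the even part, `part 1` the odd part. -/
structure Superspace (V : Type u) [AddCommGroup V] [Module ℂ V] where
  part : ZMod 2 → Submodule ℂ V
  isCompl : IsCompl (part 0) (part 1)

/-- The Koszul sign `(-1)^{ij}`. -/
def koszul (i j : ZMod 2) : ℂ := if i = 1 ∧ j = 1 then -1 else 1

theorem zmod_two_cases (i : ZMod 2) : i = 0 ∨ i = 1 := by
  revert i; decide

theorem koszul_comm (i j : ZMod 2) : koszul i j = koszul j i := by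
  simp only [koszul, and_comm]

theorem koszul_mul_self (i j : ZMod 2) : koszul i j * koszul i j = 1 := by
  unfold koszul; split_ifs <;> norm_num

theorem koszul_add (i j k : ZMod 2) : koszul (i + j) k = koszul i k * koszul j k := by
  have h : (1 + 1 : ZMod 2) = 0 := rfl
  rcases zmod_two_cases i with rfl | rfl <;> rcases zmod_two_cases j with rfl | rfl <;>
    rcases zmod_two_cases k with rfl | rfl <;> simp [koszul, h]

namespace Superspace

variable {V : Type u} [AddCommGroup V] [Module ℂ V] {W : Type v} [AddCommGroup W] [Module ℂ W]

/-- The projection onto the homogeneous component of parity `i`. -/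
def proj (S : Superspace V) (i : ZMod 2) : V →ₗ[ℂ] V :=
  if i = 0 then (S.part 0).projection (S.part 1) S.isCompl
  else (S.part 1).projection (S.part 0) S.isCompl.symm

theorem proj_of_mem (S : Superspace V) {i j : ZMod 2} {x : V} (hx : x ∈ S.part i) :
    S.proj j x = if j = i then x else 0 := by
  rcases zmod_two_cases i with rfl | rfl <;> rcases zmod_two_cases j with rfl | rfl
  · simp [proj, Submodule.projection_apply_of_mem_left S.isCompl hx]
  · simp [proj, Submodule.projection_apply_of_mem_right S.isCompl.symm hx]
  · simp [proj, Submodule.projection_apply_of_mem_right S.isCompl hx]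
  · simp [proj, Submodule.projection_apply_of_mem_left S.isCompl.symm hx]

theorem sum_proj (S : Superspace V) (x : V) : S.proj 0 x + S.proj 1 x = x := by
  have hx : x ∈ S.part 0 ⊔ S.part 1 := by rw [S.isCompl.sup_eq_top]; trivial
  obtain ⟨y, hy, z, hz, rfl⟩ := Submodule.mem_sup.1 hx
  simp [S.proj_of_mem hy, S.proj_of_mem hz]

/-- A graded subspace: every element is the sum of an even and an odd element of it. -/
def IsGraded (S : Superspace V) (N : Submodule ℂ V) : Prop :=
  N ≤ (N ⊓ S.part 0) ⊔ (N ⊓ S.part 1)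

theorem IsGraded.proj_mem {S : Superspace V} {N : Submodule ℂ V} (hN : S.IsGraded N) {x : V}
    (hx : x ∈ N) (i : ZMod 2) : S.proj i x ∈ N := by
  obtain ⟨y, hy, z, hz, rfl⟩ := Submodule.mem_sup.1 (hN hx)
  rw [map_add, S.proj_of_mem hy.2, S.proj_of_mem hz.2]
  refine add_mem ?_ ?_ <;> split_ifs
  exacts [hy.1, zero_mem _, hz.1, zero_mem _]

/-- The grading of a graded subspace. -/
def sub (S : Superspace V) (N : Submodule ℂ V) (hN : S.IsGraded N) : Superspace N where
  part i := (S.part i).comap N.subtype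
  isCompl := by
    constructor
    · rw [Submodule.disjoint_def]
      intro x h0 h1
      exact Subtype.ext (Submodule.disjoint_def.1 S.isCompl.disjoint x.1 h0 h1)
    · rw [codisjoint_iff, eq_top_iff]
      rintro ⟨x, hx⟩ -
      obtain ⟨y, hy, z, hz, rfl⟩ := Submodule.mem_sup.1 (hN hx)
      exact Submodule.mem_sup.2 ⟨⟨y, hy.1⟩, hy.2, ⟨z, hz.1⟩, hz.2, rfl⟩

/-- The grading of the quotient by a graded subspace. -/
def quot (S : Superspace V) (N : Submodule ℂ V) (hN : S.IsGraded N) : Superspace (V ⧸ N) where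
  part i := (S.part i).map N.mkQ
  isCompl := by
    constructor
    · rw [Submodule.disjoint_def]
      rintro _ ⟨x, hx, rfl⟩ ⟨y, hy, hxy⟩
      have h : y - x ∈ N := (Submodule.Quotient.eq N).1 hxy
      obtain ⟨n, hn, m, hm, hnm⟩ := Submodule.mem_sup.1 (hN h)
      have h2 : x + n ∈ S.part 0 := add_mem hx hn.2
      have h3 : x + n = y - m := by
        rw [eq_sub_iff_add_eq, add_assoc, hnm]; abel
      have h4 := Submodule.disjoint_def.1 S.isCompl.disjoint _ h2
        (h3 ▸ sub_mem hy hm.2)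
      have h5 : x = -n := eq_neg_of_add_eq_zero_left h4
      exact (Submodule.Quotient.mk_eq_zero N).2 (h5 ▸ neg_mem hn.1)
    · rw [codisjoint_iff, ← Submodule.map_sup, S.isCompl.sup_eq_top, Submodule.map_top,
        Submodule.range_mkQ]

/-- The parity change. -/
def shift (S : Superspace V) : Superspace V where
  part i := S.part (i + 1)
  isCompl := S.isCompl.symm

/-- The direct sum of two superspaces. -/
def prod (S : Superspace V) (T : Superspace W) : Superspace (V × W) where
  part i := (S.part i).prod (T.part i)
  isCompl := by
    constructor
    · rw [Submodule.disjoint_def]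
      rintro ⟨x, y⟩ h0 h1
      exact Prod.ext (Submodule.disjoint_def.1 S.isCompl.disjoint x h0.1 h1.1)
        (Submodule.disjoint_def.1 T.isCompl.disjoint y h0.2 h1.2)
    · rw [codisjoint_iff, Submodule.prod_sup_prod, S.isCompl.sup_eq_top, T.isCompl.sup_eq_top,
        Submodule.prod_top]

/-- Indices of parity `i` in `ℤ ⊕ ℤ`: the left summand is even, the right one odd. -/
def idx (i : ZMod 2) (k : ℤ) : ℤ ⊕ ℤ := if i = 0 then Sum.inl k else Sum.inr k

@[simp] theorem idx_zero (k : ℤ) : idx 0 k = Sum.inl k := rfl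
@[simp] theorem idx_one (k : ℤ) : idx 1 k = Sum.inr k := rfl

/-- The grading for which the basis vectors indexed by the left summand are even and those
indexed by the right summand are odd. -/
def ofBasis (b : Basis (ℤ ⊕ ℤ) ℂ V) : Superspace V where
  part i := Submodule.span ℂ (Set.range fun k => b (idx i k))
  isCompl := by
    have h := b.linearIndependent.isCompl_span_image b.span_eq
      (Set.isCompl_range_inl_range_inr (α := ℤ) (β := ℤ))
    rw [← Set.range_comp, ← Set.range_comp] at h
    exact h

theorem ofBasis_mem (b : Basis (ℤ ⊕ ℤ) ℂ V) (i : ZMod 2) (k : ℤ) :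
    b (idx i k) ∈ (ofBasis b).part i := Submodule.subset_span ⟨k, rfl⟩

theorem ofBasis_induction (b : Basis (ℤ ⊕ ℤ) ℂ V) {i : ZMod 2} {P : V → Prop}
    (hb : ∀ k, P (b (idx i k))) (hadd : ∀ x y, P x → P y → P (x + y))
    (hsmul : ∀ (c : ℂ) x, P x → P (c • x)) {x : V} (hx : x ∈ (ofBasis b).part i) : P x := by
  refine Submodule.span_induction (p := fun x _ => P x) ?_ ?_ ?_ ?_ hx
  · rintro _ ⟨k, rfl⟩
    exact hb k
  · simpa using hsmul 0 _ (hb 0)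
  · exact fun x y _ _ => hadd x y
  · exact fun c x _ => hsmul c x

end Superspace

/-! ### Lie superalgebras and their modules -/

/-- A Lie superalgebra over `ℂ`. -/
class LieSuperalgebra (𝔤 : Type u) [AddCommGroup 𝔤] [Module ℂ 𝔤] where
  gr : Superspace 𝔤
  brk : 𝔤 →ₗ[ℂ] 𝔤 →ₗ[ℂ] 𝔤
  brk_mem : ∀ {i j : ZMod 2} {x y : 𝔤}, x ∈ gr.part i → y ∈ gr.part j → brk x y ∈ gr.part (i + j)
  brk_skew : ∀ {i j : ZMod 2} {x y : 𝔤}, x ∈ gr.part i → y ∈ gr.part j →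
    brk x y = -(koszul i j • brk y x)
  jacobi : ∀ {i j k : ZMod 2} {x y z : 𝔤}, x ∈ gr.part i → y ∈ gr.part j → z ∈ gr.part k →
    brk x (brk y z) = brk (brk x y) z + koszul i j • brk y (brk x z)

open LieSuperalgebra

/-- A graded subalgebra of a Lie superalgebra. -/
structure LieSubsuperalgebra (𝔤 : Type u) [AddCommGroup 𝔤] [Module ℂ 𝔤] [LieSuperalgebra 𝔤] where
  carrier : Submodule ℂ 𝔤
  isGraded : (gr (𝔤 := 𝔤)).IsGraded carrier
  brk_mem : ∀ {x y : 𝔤}, x ∈ carrier → y ∈ carrier → brk x y ∈ carrier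

/-- A graded subalgebra is itself a Lie superalgebra. -/
instance (𝔤 : Type u) [AddCommGroup 𝔤] [Module ℂ 𝔤] [LieSuperalgebra 𝔤]
    (S : LieSubsuperalgebra 𝔤) : LieSuperalgebra S.carrier where
  gr := (gr (𝔤 := 𝔤)).sub S.carrier S.isGraded
  brk := LinearMap.mk₂ ℂ (fun x y => ⟨brk (x : 𝔤) (y : 𝔤), S.brk_mem x.2 y.2⟩)
    (fun x y z => Subtype.ext (by simp)) (fun c x y => Subtype.ext (by simp))
    (fun x y z => Subtype.ext (by simp)) (fun c x y => Subtype.ext (by simp))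
  brk_mem := fun {_ _ x y} hx hy => LieSuperalgebra.brk_mem (x := x.1) (y := y.1) hx hy
  brk_skew := fun {_ _ x y} hx hy => Subtype.ext (brk_skew (x := x.1) (y := y.1) hx hy)
  jacobi := fun {_ _ _ x y z} hx hy hz =>
    Subtype.ext (jacobi (x := x.1) (y := y.1) (z := z.1) hx hy hz)

/-- The structure of a module over the Lie superalgebra `𝔤` on a complex vector space `M`
(including the `ℤ/2`-grading of `M`). -/
structure SuperModule (𝔤 : Type u) [AddCommGroup 𝔤] [Module ℂ 𝔤] [LieSuperalgebra 𝔤]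
    (M : Type v) [AddCommGroup M] [Module ℂ M] where
  gr : Superspace M
  act : 𝔤 →ₗ[ℂ] M →ₗ[ℂ] M
  act_mem : ∀ {i j : ZMod 2} {x : 𝔤} {m : M}, x ∈ (LieSuperalgebra.gr (𝔤 := 𝔤)).part i →
    m ∈ gr.part j → act x m ∈ gr.part (i + j)
  act_brk : ∀ {i j : ZMod 2} {x y : 𝔤}, x ∈ (LieSuperalgebra.gr (𝔤 := 𝔤)).part i →
    y ∈ (LieSuperalgebra.gr (𝔤 := 𝔤)).part j → ∀ m : M,
    act (brk x y) m = act x (act y m) - koszul i j • act y (act x m)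

namespace SuperModule

variable {𝔤 : Type u} [AddCommGroup 𝔤] [Module ℂ 𝔤] [LieSuperalgebra 𝔤]
  {M : Type v} [AddCommGroup M] [Module ℂ M] {N : Type w} [AddCommGroup N] [Module ℂ N]

/-- A submodule (in the super sense: a graded subspace stable under the action). -/
structure IsSubmodule (X : SuperModule 𝔤 M) (P : Submodule ℂ M) : Prop where
  isGraded : X.gr.IsGraded P
  act_mem : ∀ (x : 𝔤) {m : M}, m ∈ P → X.act x m ∈ P

/-- A module is simple if it is nonzero and has no submodules besides `0` and itself. -/
def IsSimple (X : SuperModule 𝔤 M) : Prop :=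
  Nontrivial M ∧ ∀ P : Submodule ℂ M, X.IsSubmodule P → P = ⊥ ∨ P = ⊤

/-- Isomorphism of modules: an even linear bijection commuting with the action. -/
def Iso (X : SuperModule 𝔤 M) (Y : SuperModule 𝔤 N) : Prop :=
  ∃ f : M ≃ₗ[ℂ] N, (∀ i, ∀ m ∈ X.gr.part i, f m ∈ Y.gr.part i) ∧
    ∀ x m, f (X.act x m) = Y.act x (f m)

/-- The module with the same action and the opposite parity. -/
def parityChange (X : SuperModule 𝔤 M) : SuperModule 𝔤 M where
  gr := X.gr.shift
  act := X.act
  act_mem := fun {i j x m} hx hm => by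
    have h := X.act_mem hx (j := j + 1) hm
    rwa [← add_assoc] at h
  act_brk := X.act_brk

/-- Isomorphism up to a parity change. -/
def IsoUpToParity (X : SuperModule 𝔤 M) (Y : SuperModule 𝔤 N) : Prop :=
  X.Iso Y ∨ X.Iso Y.parityChange

/-- Restriction of a module to a subalgebra. -/
def restrict (X : SuperModule 𝔤 M) (S : LieSubsuperalgebra 𝔤) : SuperModule S.carrier M where
  gr := X.gr
  act := X.act ∘ₗ S.carrier.subtype
  act_mem := fun {_ _ x _} hx hm => X.act_mem (x := x.1) hx hm
  act_brk := fun {_ _ x y} hx hy => X.act_brk (x := x.1) (y := y.1) hx hy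

/-- A submodule, as a module. -/
def sub (X : SuperModule 𝔤 M) (P : Submodule ℂ M) (hP : X.IsSubmodule P) : SuperModule 𝔤 P where
  gr := X.gr.sub P hP.isGraded
  act := LinearMap.mk₂ ℂ (fun x m => ⟨X.act x m, hP.act_mem x m.2⟩)
    (fun x y z => Subtype.ext (by simp)) (fun c x y => Subtype.ext (by simp))
    (fun x y z => Subtype.ext (by simp)) (fun c x y => Subtype.ext (by simp))
  act_mem := fun {_ _ _ m} hx hm => X.act_mem (m := m.1) hx hm
  act_brk := fun hx hy m => Subtype.ext (X.act_brk hx hy m.1)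

/-- The quotient by a submodule. -/
def quot (X : SuperModule 𝔤 M) (P : Submodule ℂ M) (hP : X.IsSubmodule P) :
    SuperModule 𝔤 (M ⧸ P) where
  gr := X.gr.quot P hP.isGraded
  act :=
    { toFun := fun x => P.mapQ P (X.act x) fun _ hm => hP.act_mem x hm
      map_add' := fun x y => Submodule.linearMap_qext _ (by ext m; simp)
      map_smul' := fun c x => Submodule.linearMap_qext _ (by ext m; simp) }
  act_mem := by
    rintro i j x _ hx ⟨m, hm, rfl⟩
    exact ⟨X.act x m, X.act_mem hx hm, rfl⟩
  act_brk := by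
    intro i j x y hx hy m
    obtain ⟨m, rfl⟩ := Submodule.mkQ_surjective P m
    exact congrArg P.mkQ (X.act_brk hx hy m)

end SuperModule

/-- For homogeneous `a` and `y`, this is `(-1)^{|a||y|} y ∘ a`. -/
def twist {𝔤 : Type u} [AddCommGroup 𝔤] [Module ℂ 𝔤] [LieSuperalgebra 𝔤]
    {V : Type v} [AddCommGroup V] [Module ℂ V] (X : SuperModule 𝔤 V) : V →ₗ[ℂ] 𝔤 →ₗ[ℂ] V :=
  ∑ i : ZMod 2, ∑ j : ZMod 2,
    koszul i j • (X.act.compl₁₂ ((LieSuperalgebra.gr (𝔤 := 𝔤)).proj j) (X.gr.proj i)).flip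

theorem twist_apply {𝔤 : Type u} [AddCommGroup 𝔤] [Module ℂ 𝔤] [LieSuperalgebra 𝔤]
    {V : Type v} [AddCommGroup V] [Module ℂ V] (X : SuperModule 𝔤 V) {i j : ZMod 2} {a : V} {y : 𝔤}
    (ha : a ∈ X.gr.part i) (hy : y ∈ (LieSuperalgebra.gr (𝔤 := 𝔤)).part j) :
    twist X a y = koszul i j • X.act y a := by
  have h : ∀ f : ZMod 2 → V, ∑ k : ZMod 2, f k = f 0 + f 1 := fun f => Fin.sum_univ_two f
  simp only [twist, LinearMap.sum_apply, LinearMap.smul_apply, LinearMap.flip_apply,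
    LinearMap.compl₁₂_apply, Superspace.proj_of_mem _ ha, Superspace.proj_of_mem _ hy, h]
  rcases zmod_two_cases i with rfl | rfl <;> rcases zmod_two_cases j with rfl | rfl <;> simp

/-- The semidirect product `𝔤 ⋉ V` with a `𝔤`-module `V` regarded as an abelian Lie superalgebra:
for homogeneous elements, `[(x, a), (y, b)] = ([x, y], x ∘ b - (-1)^{|a||y|} y ∘ a)`. -/
abbrev semidirect {𝔤 : Type u} [AddCommGroup 𝔤] [Module ℂ 𝔤] [LieSuperalgebra 𝔤]
    {V : Type v} [AddCommGroup V] [Module ℂ V] (X : SuperModule 𝔤 V) : LieSuperalgebra (𝔤 × V) where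
  gr := (gr (𝔤 := 𝔤)).prod X.gr
  brk := LinearMap.mk₂ ℂ (fun p q => (brk p.1 q.1, X.act p.1 q.2 - twist X p.2 q.1))
    (fun p q r => Prod.ext (by simp) (by simp; abel))
    (fun c p q => Prod.ext (by simp) (by simp [smul_sub]))
    (fun p q r => Prod.ext (by simp) (by simp; abel))
    (fun c p q => Prod.ext (by simp) (by simp [smul_sub]))
  brk_mem := by
    rintro i j ⟨x, a⟩ ⟨y, b⟩ ⟨hx, ha⟩ ⟨hy, hb⟩
    refine ⟨LieSuperalgebra.brk_mem hx hy, sub_mem (X.act_mem hx hb) ?_⟩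
    simp only at ha hy
    rw [twist_apply X ha hy, add_comm]
    exact Submodule.smul_mem _ _ (X.act_mem hy ha)
  brk_skew := by
    rintro i j ⟨x, a⟩ ⟨y, b⟩ ⟨hx, ha⟩ ⟨hy, hb⟩
    refine Prod.ext (brk_skew hx hy) ?_
    simp only at ha hy hx hb
    simp only [LinearMap.mk₂_apply, twist_apply X ha hy, twist_apply X hb hx, Prod.snd_neg,
      Prod.smul_snd, smul_sub, smul_smul, koszul_comm j i, koszul_mul_self]
    module
  jacobi := by
    rintro i j k ⟨x, a⟩ ⟨y, b⟩ ⟨z, c⟩ ⟨hx, ha⟩ ⟨hy, hb⟩ ⟨hz, hc⟩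
    refine Prod.ext (jacobi hx hy hz) ?_
    simp only at ha hy hx hb hz hc
    simp only [LinearMap.mk₂_apply, twist_apply X ha hy, twist_apply X hb hx, twist_apply X ha hz,
      twist_apply X hb hz, twist_apply X ha (LieSuperalgebra.brk_mem hy hz),
      twist_apply X hb (LieSuperalgebra.brk_mem hx hz), map_sub, map_smul, LinearMap.sub_apply,
      LinearMap.smul_apply, twist_apply X (X.act_mem hx hb) hz,
      twist_apply X (X.act_mem hy ha) hz, X.act_brk hy hz, X.act_brk hx hz, X.act_brk hx hy,
      Prod.snd_add, Prod.smul_snd, koszul_add, koszul_comm _ (_ + _), koszul_comm j i,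
      koszul_comm k i, koszul_comm k j, smul_sub, smul_smul]
    rcases zmod_two_cases i with rfl | rfl <;> rcases zmod_two_cases j with rfl | rfl <;>
      rcases zmod_two_cases k with rfl | rfl <;> simp [koszul] <;> abel

/-! ### The centerless Neveu-Schwarz algebra and the superalgebra `ℂ[t, t⁻¹] ⊗ Λ(1)` -/

/-- The underlying space of `𝔨`: the basis vector with index `inl n` is `L_n`, the one with index
`inr n` is `G_{n + 1/2}`. -/
abbrev K : Type := ℤ ⊕ ℤ →₀ ℂ

/-- The basis of `𝔨`. -/
def K.basis : Basis (ℤ ⊕ ℤ) ℂ K := Finsupp.basisSingleOne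

/-- The element `L_n`. -/
def L (n : ℤ) : K := K.basis (Sum.inl n)

/-- The element `G_{n + 1/2}`. -/
def G (n : ℤ) : K := K.basis (Sum.inr n)

/-- The bracket of `𝔨` on basis vectors, `[L_m, L_n] = (n - m) L_{m+n}`,
`[L_m, G_r] = (r - m/2) G_{m+r}`, `[G_r, L_m] = -[L_m, G_r]`, `[G_r, G_s] = -2 L_{r+s}`. -/
def K.brkBasis : ℤ ⊕ ℤ → ℤ ⊕ ℤ → K
  | .inl m, .inl n => ((n : ℂ) - m) • L (m + n)
  | .inl m, .inr n => ((n : ℂ) + 1 / 2 - m / 2) • G (m + n)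
  | .inr n, .inl m => -(((n : ℂ) + 1 / 2 - m / 2) • G (m + n))
  | .inr m, .inr n => (-2 : ℂ) • L (m + n + 1)

/-- The bilinear extension of the bracket. -/
def K.brk : K →ₗ[ℂ] K →ₗ[ℂ] K :=
  K.basis.constr ℂ fun x => K.basis.constr ℂ fun y => K.brkBasis x y

theorem K.brk_basis (x y : ℤ ⊕ ℤ) : K.brk (K.basis x) (K.basis y) = K.brkBasis x y := by
  simp [K.brk]

theorem K.brk_LL (m n : ℤ) : K.brk (L m) (L n) = ((n : ℂ) - m) • L (m + n) := K.brk_basis _ _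
theorem K.brk_LG (m n : ℤ) : K.brk (L m) (G n) = ((n : ℂ) + 1 / 2 - m / 2) • G (m + n) :=
  K.brk_basis _ _
theorem K.brk_GL (m n : ℤ) : K.brk (G n) (L m) = -(((n : ℂ) + 1 / 2 - m / 2) • G (m + n)) :=
  K.brk_basis _ _
theorem K.brk_GG (m n : ℤ) : K.brk (G m) (G n) = (-2 : ℂ) • L (m + n + 1) := K.brk_basis _ _

/-- The grading of `𝔨`, with `L_n` even and `G_r` odd. -/
def K.gr : Superspace K := Superspace.ofBasis K.basis

theorem L_mem (n : ℤ) : L n ∈ K.gr.part 0 := Superspace.ofBasis_mem K.basis 0 n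
theorem G_mem (n : ℤ) : G n ∈ K.gr.part 1 := Superspace.ofBasis_mem K.basis 1 n
theorem K.basis_inl (n : ℤ) : K.basis (Sum.inl n) = L n := rfl
theorem K.basis_inr (n : ℤ) : K.basis (Sum.inr n) = G n := rfl

theorem K.brk_mem {i j : ZMod 2} {x y : K} (hx : x ∈ K.gr.part i) (hy : y ∈ K.gr.part j) :
    K.brk x y ∈ K.gr.part (i + j) := by
  refine Superspace.ofBasis_induction K.basis (P := fun x => K.brk x y ∈ K.gr.part (i + j))
    (fun m => ?_) (fun x x' h h' => ?_) (fun c x h => ?_) hx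
  · refine Superspace.ofBasis_induction K.basis
      (P := fun y => K.brk (K.basis (Superspace.idx i m)) y ∈ K.gr.part (i + j))
      (fun n => ?_) (fun y y' h h' => ?_) (fun c y h => ?_) hy
    · rcases zmod_two_cases i with rfl | rfl <;> rcases zmod_two_cases j with rfl | rfl <;>
        simp only [Superspace.idx_zero, Superspace.idx_one, K.basis_inl, K.basis_inr, K.brk_LL,
          K.brk_LG, K.brk_GL, K.brk_GG]
      · exact Submodule.smul_mem _ _ (L_mem _)
      · exact Submodule.smul_mem _ _ (G_mem _)
      · exact neg_mem (Submodule.smul_mem _ _ (G_mem _))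
      · exact Submodule.smul_mem _ _ (L_mem _)
    · simpa using add_mem h h'
    · simpa using Submodule.smul_mem _ c h
  · simpa using add_mem h h'
  · simpa using Submodule.smul_mem _ c h

theorem K.brk_skew {i j : ZMod 2} {x y : K} (hx : x ∈ K.gr.part i) (hy : y ∈ K.gr.part j) :
    K.brk x y = -(koszul i j • K.brk y x) := by
  refine Superspace.ofBasis_induction K.basis (P := fun x => K.brk x y = -(koszul i j • K.brk y x))
    (fun m => ?_) (fun x x' h h' => ?_) (fun c x h => ?_) hx
  · refine Superspace.ofBasis_induction K.basis
      (P := fun y => K.brk (K.basis (Superspace.idx i m)) y =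
        -(koszul i j • K.brk y (K.basis (Superspace.idx i m))))
      (fun n => ?_) (fun y y' h h' => ?_) (fun c y h => ?_) hy
    · rcases zmod_two_cases i with rfl | rfl <;> rcases zmod_two_cases j with rfl | rfl <;>
        simp only [Superspace.idx_zero, Superspace.idx_one, K.basis_inl, K.basis_inr, K.brk_LL,
          K.brk_LG, K.brk_GL, K.brk_GG, add_comm n m] <;> simp [koszul] <;> module
    · simp only [map_add, LinearMap.add_apply, h, h']; module
    · simp only [map_smul, LinearMap.smul_apply, h]; module
  · simp only [map_add, LinearMap.add_apply, h, h']; module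
  · simp only [map_smul, LinearMap.smul_apply, h]; module

theorem K.jacobi {i j k : ZMod 2} {x y z : K} (hx : x ∈ K.gr.part i) (hy : y ∈ K.gr.part j)
    (hz : z ∈ K.gr.part k) :
    K.brk x (K.brk y z) = K.brk (K.brk x y) z + koszul i j • K.brk y (K.brk x z) := by
  refine Superspace.ofBasis_induction K.basis (P := fun x =>
    K.brk x (K.brk y z) = K.brk (K.brk x y) z + koszul i j • K.brk y (K.brk x z))
    (fun l => ?_) (fun x x' h h' => ?_) (fun c x h => ?_) hx
  · generalize hX : K.basis (Superspace.idx i l) = X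
    refine Superspace.ofBasis_induction K.basis (P := fun y =>
      K.brk X (K.brk y z) = K.brk (K.brk X y) z + koszul i j • K.brk y (K.brk X z))
      (fun m => ?_) (fun y y' h h' => ?_) (fun c y h => ?_) hy
    · generalize hY : K.basis (Superspace.idx j m) = Y
      refine Superspace.ofBasis_induction K.basis (P := fun z =>
        K.brk X (K.brk Y z) = K.brk (K.brk X Y) z + koszul i j • K.brk Y (K.brk X z))
        (fun n => ?_) (fun y y' h h' => ?_) (fun c y h => ?_) hz
      · subst hX hY
        rcases zmod_two_cases i with rfl | rfl <;> rcases zmod_two_cases j with rfl | rfl <;>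
          rcases zmod_two_cases k with rfl | rfl <;>
          simp only [Superspace.idx_zero, Superspace.idx_one, K.basis_inl, K.basis_inr, K.brk_LL,
            K.brk_LG, K.brk_GL, K.brk_GG, map_smul, map_neg, LinearMap.smul_apply,
            LinearMap.neg_apply, koszul, smul_smul, smul_neg, neg_neg] <;>
          push_cast <;> ring_nf <;> simp <;> module
      · simp only [map_add, LinearMap.add_apply, h, h']; module
      · simp only [map_smul, LinearMap.smul_apply, h]; module
    · simp only [map_add, LinearMap.add_apply, h, h']; module
    · simp only [map_smul, LinearMap.smul_apply, h]; module
  · simp only [map_add, LinearMap.add_apply, h, h']; module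
  · simp only [map_smul, LinearMap.smul_apply, h]; module

/-- The centerless Neveu-Schwarz algebra `𝔨`. -/
instance : LieSuperalgebra K where
  gr := K.gr
  brk := K.brk
  brk_mem := K.brk_mem
  brk_skew := K.brk_skew
  jacobi := K.jacobi

/-- The superalgebra `A = ℂ[t, t⁻¹] ⊗ Λ(1) = ℂ[t, t⁻¹][ξ]` with `ξ² = 0`. -/
abbrev A : Type := DualNumber (LaurentPolynomial ℂ)

/-- The element `t ^ n` of `A`. -/
def t (n : ℤ) : A := TrivSqZeroExt.inl (LaurentPolynomial.T n)

/-- The odd generator `ξ` of `A`. -/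
def ξ : A := DualNumber.eps

/-- The basis of `A` whose vector with index `inl n` is `t^n` and whose vector with index `inr n`
is `t^n ξ`. -/
def A.basis : Basis (ℤ ⊕ ℤ) ℂ A :=
  .ofRepr
    { toFun := fun x => (Finsupp.sumFinsuppLEquivProdFinsupp ℂ).symm (x.fst.coeff, x.snd.coeff)
      invFun := fun f => (AddMonoidAlgebra.ofCoeff (Finsupp.sumFinsuppLEquivProdFinsupp ℂ f).1,
        AddMonoidAlgebra.ofCoeff (Finsupp.sumFinsuppLEquivProdFinsupp ℂ f).2)
      map_add' := fun x y => by rw [← map_add]; rfl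
      map_smul' := fun c x => by rw [RingHom.id_apply, ← map_smul]; rfl
      left_inv := fun x => by simp only [LinearEquiv.apply_symm_apply]; rfl
      right_inv := fun f => by
        apply (Finsupp.sumFinsuppLEquivProdFinsupp ℂ).injective
        rw [LinearEquiv.apply_symm_apply]; rfl }

theorem A.repr_inl (x : A) (k : ℤ) : A.basis.repr x (Sum.inl k) = x.fst.coeff k := rfl
theorem A.repr_inr (x : A) (k : ℤ) : A.basis.repr x (Sum.inr k) = x.snd.coeff k := rfl

theorem A.basis_inl (n : ℤ) : A.basis (Sum.inl n) = t n := by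
  apply A.basis.repr.injective
  rw [Basis.repr_self]
  ext (k | k)
  · simp [A.repr_inl, t, LaurentPolynomial.T, Finsupp.single_apply,
      -LaurentPolynomial.single_eq_C_mul_T]
  · simp [A.repr_inr, t]

theorem A.basis_inr (n : ℤ) : A.basis (Sum.inr n) = t n * ξ := by
  apply A.basis.repr.injective
  rw [Basis.repr_self]
  ext (k | k)
  · simp [A.repr_inl, t, ξ]
  · simp [A.repr_inr, t, ξ, LaurentPolynomial.T, Finsupp.single_apply,
      -LaurentPolynomial.single_eq_C_mul_T]

theorem t_mul_t (m n : ℤ) : t m * t n = t (m + n) := by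
  rw [t, t, t, LaurentPolynomial.T_add, TrivSqZeroExt.inl_mul]
theorem t_zero : t 0 = 1 := rfl
theorem ξ_mul_ξ : ξ * ξ = 0 := DualNumber.eps_mul_eps

theorem t_mul_tξ (m n : ℤ) : t m * (t n * ξ) = t (m + n) * ξ := by
  rw [← mul_assoc, t_mul_t]
theorem tξ_mul_t (m n : ℤ) : (t m * ξ) * t n = t (m + n) * ξ := by
  rw [mul_right_comm, t_mul_t]
theorem tξ_mul_tξ (m n : ℤ) : (t m * ξ) * (t n * ξ) = 0 := by
  rw [mul_mul_mul_comm, ξ_mul_ξ, mul_zero]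

/-- The grading of `A`, with `t` even and `ξ` odd. -/
def A.gr : Superspace A := Superspace.ofBasis A.basis

/-- The derivation `∂/∂t` of `A`. -/
def dt : A →ₗ[ℂ] A := A.basis.constr ℂ
  (Sum.elim (fun k => (k : ℂ) • t (k - 1)) (fun k => (k : ℂ) • (t (k - 1) * ξ)))

/-- The derivation `∂/∂ξ` of `A`. -/
def dξ : A →ₗ[ℂ] A := A.basis.constr ℂ (Sum.elim (fun _ => 0) (fun k => t k))

theorem dt_t (k : ℤ) : dt (t k) = (k : ℂ) • t (k - 1) := by simp [dt, ← A.basis_inl]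
theorem dt_tξ (k : ℤ) : dt (t k * ξ) = (k : ℂ) • (t (k - 1) * ξ) := by
  simp [dt, ← A.basis_inr]
theorem dξ_t (k : ℤ) : dξ (t k) = 0 := by simp [dξ, ← A.basis_inl]
theorem dξ_tξ (k : ℤ) : dξ (t k * ξ) = t k := by simp [dξ, ← A.basis_inr]

/-! ### The modules `A` and `Γ(λ, b)` -/

/-- The operator `x ↦ L_n ∘ x = t^{n+1} ∂_t(x) + (n+1)/2 t^n ξ ∂_ξ(x)` on `A`. -/
def circL (n : ℤ) : A →ₗ[ℂ] A :=
  LinearMap.mulLeft ℂ (t (n + 1)) ∘ₗ dt +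
    ((1 / 2 : ℂ) * ((n : ℂ) + 1)) • (LinearMap.mulLeft ℂ (t n * ξ) ∘ₗ dξ)

/-- The operator `x ↦ G_{n+1/2} ∘ x = t^{n+1} ξ ∂_t(x) - t^{n+1} ∂_ξ(x)` on `A`. -/
def circG (n : ℤ) : A →ₗ[ℂ] A :=
  LinearMap.mulLeft ℂ (t (n + 1) * ξ) ∘ₗ dt - LinearMap.mulLeft ℂ (t (n + 1)) ∘ₗ dξ

/-- The action of `𝔨` on `A` by contact vector fields. -/
def circ : K →ₗ[ℂ] A →ₗ[ℂ] A := K.basis.constr ℂ (Sum.elim circL circG)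

/-- The action of `L_n` on `Γ(l, b)`. -/
def gammaL (l b : ℂ) (n : ℤ) : A →ₗ[ℂ] A := A.basis.constr ℂ
  (Sum.elim (fun k => (l + k + b * (n + 1)) • t (n + k))
    (fun k => (l + k + (n + 1) * (b + 1 / 2)) • (t (n + k) * ξ)))

/-- The action of `G_{n+1/2}` on `Γ(l, b)`. -/
def gammaG (l b : ℂ) (n : ℤ) : A →ₗ[ℂ] A := A.basis.constr ℂ
  (Sum.elim (fun k => (k + l + 2 * b * (n + 1)) • (t (n + k) * ξ)) (fun k => -t (n + k + 1)))

/-- The action of `𝔨` on `Γ(l, b)`. -/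
def gammaK (l b : ℂ) : K →ₗ[ℂ] A →ₗ[ℂ] A := K.basis.constr ℂ (Sum.elim (gammaL l b) (gammaG l b))

theorem gammaK_L_t (l b : ℂ) (n k : ℤ) :
    gammaK l b (L n) (t k) = (l + k + b * (n + 1)) • t (n + k) := by
  simp [gammaK, L, gammaL, ← A.basis_inl]

theorem gammaK_L_tξ (l b : ℂ) (n k : ℤ) :
    gammaK l b (L n) (t k * ξ) = (l + k + (n + 1) * (b + 1 / 2)) • (t (n + k) * ξ) := by
  simp [gammaK, L, gammaL, ← A.basis_inr]

theorem gammaK_G_t (l b : ℂ) (n k : ℤ) :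
    gammaK l b (G n) (t k) = (k + l + 2 * b * (n + 1)) • (t (n + k) * ξ) := by
  simp [gammaK, G, gammaG, ← A.basis_inl]

theorem gammaK_G_tξ (l b : ℂ) (n k : ℤ) :
    gammaK l b (G n) (t k * ξ) = -t (n + k + 1) := by
  simp [gammaK, G, gammaG, ← A.basis_inr]

theorem A.induction {P : A → Prop} (ht : ∀ k, P (t k)) (hξ : ∀ k, P (t k * ξ))
    (hadd : ∀ x y, P x → P y → P (x + y)) (hsmul : ∀ (c : ℂ) x, P x → P (c • x)) (x : A) : P x := by
  have hx : x ∈ Submodule.span ℂ (Set.range A.basis) := by rw [A.basis.span_eq]; trivial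
  refine Submodule.span_induction (p := fun x _ => P x) ?_ ?_ ?_ ?_ hx
  · rintro _ ⟨k | k, rfl⟩
    · exact A.basis_inl k ▸ ht k
    · exact A.basis_inr k ▸ hξ k
  · simpa using hsmul 0 _ (ht 0)
  · exact fun x y _ _ => hadd x y
  · exact fun c x _ => hsmul c x

theorem t_mem (n : ℤ) : t n ∈ A.gr.part 0 := A.basis_inl n ▸ Superspace.ofBasis_mem A.basis 0 n
theorem tξ_mem (n : ℤ) : t n * ξ ∈ A.gr.part 1 :=
  A.basis_inr n ▸ Superspace.ofBasis_mem A.basis 1 n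

theorem circ_eq : circ = gammaK 0 0 := by
  have h : (Sum.elim circL circG) = Sum.elim (gammaL 0 0) (gammaG 0 0) := by
    funext x
    rcases x with n | n <;> refine A.basis.ext fun x => ?_ <;> rcases x with k | k
    · simp only [Sum.elim_inl, gammaL, Basis.constr_basis]
      simp only [A.basis_inl, circL, LinearMap.add_apply, LinearMap.smul_apply,
        LinearMap.comp_apply, LinearMap.mulLeft_apply, dt_t, dξ_t, mul_smul_comm, t_mul_t,
        mul_zero, smul_zero, add_zero, zero_add, zero_mul]
      ring_nf
    · simp only [Sum.elim_inr, Sum.elim_inl, gammaL, Basis.constr_basis]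
      simp only [A.basis_inr, circL, LinearMap.add_apply, LinearMap.smul_apply,
        LinearMap.comp_apply, LinearMap.mulLeft_apply, dt_tξ, dξ_tξ, mul_smul_comm, t_mul_tξ,
        tξ_mul_t]
      ring_nf
      module
    · simp only [Sum.elim_inr, Sum.elim_inl, gammaG, Basis.constr_basis]
      simp only [A.basis_inl, circG, LinearMap.sub_apply,
        LinearMap.comp_apply, LinearMap.mulLeft_apply, dt_t, dξ_t, mul_smul_comm, tξ_mul_t,
        mul_zero, sub_zero, add_zero, zero_mul]
      ring_nf
    · simp only [Sum.elim_inr, gammaG, Basis.constr_basis]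
      simp only [A.basis_inr, circG, LinearMap.sub_apply,
        LinearMap.comp_apply, LinearMap.mulLeft_apply, dt_tξ, dξ_tξ, mul_smul_comm, tξ_mul_tξ,
        smul_zero, zero_sub, t_mul_t]
      ring_nf
  rw [circ, gammaK, h]

theorem gammaK_mem (l b : ℂ) {i j : ZMod 2} {x : K} {m : A} (hx : x ∈ K.gr.part i)
    (hm : m ∈ A.gr.part j) : gammaK l b x m ∈ A.gr.part (i + j) := by
  refine Superspace.ofBasis_induction K.basis (P := fun x => gammaK l b x m ∈ A.gr.part (i + j))
    (fun n => ?_) (fun x x' h h' => ?_) (fun c x h => ?_) hx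
  · refine Superspace.ofBasis_induction A.basis
      (P := fun y => gammaK l b (K.basis (Superspace.idx i n)) y ∈ A.gr.part (i + j))
      (fun k => ?_) (fun y y' h h' => ?_) (fun c y h => ?_) hm
    · rcases zmod_two_cases i with rfl | rfl <;> rcases zmod_two_cases j with rfl | rfl <;>
        simp only [Superspace.idx_zero, Superspace.idx_one, K.basis_inl, K.basis_inr, A.basis_inl,
          A.basis_inr, gammaK_L_t, gammaK_L_tξ, gammaK_G_t, gammaK_G_tξ]
      · exact Submodule.smul_mem _ _ (t_mem _)
      · exact Submodule.smul_mem _ _ (tξ_mem _)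
      · exact Submodule.smul_mem _ _ (tξ_mem _)
      · exact neg_mem (t_mem _)
    · simpa using add_mem h h'
    · simpa using Submodule.smul_mem _ c h
  · simpa using add_mem h h'
  · simpa using Submodule.smul_mem _ c h

theorem gammaK_brk (l b : ℂ) {i j : ZMod 2} {x y : K} (hx : x ∈ K.gr.part i)
    (hy : y ∈ K.gr.part j) (m : A) : gammaK l b (K.brk x y) m =
      gammaK l b x (gammaK l b y m) - koszul i j • gammaK l b y (gammaK l b x m) := by
  refine Superspace.ofBasis_induction K.basis (P := fun x => gammaK l b (K.brk x y) m =
      gammaK l b x (gammaK l b y m) - koszul i j • gammaK l b y (gammaK l b x m))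
    (fun p => ?_) (fun x x' h h' => ?_) (fun c x h => ?_) hx
  · generalize hX : K.basis (Superspace.idx i p) = X
    refine Superspace.ofBasis_induction K.basis (P := fun y => gammaK l b (K.brk X y) m =
      gammaK l b X (gammaK l b y m) - koszul i j • gammaK l b y (gammaK l b X m))
      (fun q => ?_) (fun y y' h h' => ?_) (fun c y h => ?_) hy
    · subst hX
      induction m using A.induction with
      | ht k =>
        rcases zmod_two_cases i with rfl | rfl <;> rcases zmod_two_cases j with rfl | rfl <;>
          simp only [Superspace.idx_zero, Superspace.idx_one, K.basis_inl, K.basis_inr, K.brk_LL,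
            K.brk_LG, K.brk_GL, K.brk_GG, gammaK_L_t, gammaK_L_tξ, gammaK_G_t, gammaK_G_tξ,
            map_smul, map_neg, LinearMap.smul_apply, LinearMap.neg_apply, koszul, smul_smul] <;>
          push_cast <;> ring_nf <;> simp <;> module
      | hξ k =>
        rcases zmod_two_cases i with rfl | rfl <;> rcases zmod_two_cases j with rfl | rfl <;>
          simp only [Superspace.idx_zero, Superspace.idx_one, K.basis_inl, K.basis_inr, K.brk_LL,
            K.brk_LG, K.brk_GL, K.brk_GG, gammaK_L_t, gammaK_L_tξ, gammaK_G_t, gammaK_G_tξ,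
            map_smul, map_neg, LinearMap.smul_apply, LinearMap.neg_apply, koszul, smul_smul] <;>
          push_cast <;> ring_nf <;> simp <;> module
      | hadd x x' h h' =>
        simp only [map_add, h, h']; module
      | hsmul c x h =>
        simp only [map_smul, h]; module
    · simp only [map_add, LinearMap.add_apply, h, h']; module
    · simp only [map_smul, LinearMap.smul_apply, h]; module
  · simp only [map_add, LinearMap.add_apply, h, h']; module
  · simp only [map_smul, LinearMap.smul_apply, h]; module

/-- Compatibility of the action of `𝔨` on `Γ(l, b)` with the multiplication by `A`. -/
theorem gammaK_mul (l b : ℂ) {i j : ZMod 2} {x : K} {a : A} (hx : x ∈ K.gr.part i)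
    (ha : a ∈ A.gr.part j) (m : A) : circ x a * m =
      gammaK l b x (a * m) - koszul i j • (a * gammaK l b x m) := by
  rw [circ_eq]
  refine Superspace.ofBasis_induction K.basis (P := fun x => gammaK 0 0 x a * m =
      gammaK l b x (a * m) - koszul i j • (a * gammaK l b x m))
    (fun p => ?_) (fun x x' h h' => ?_) (fun c x h => ?_) hx
  · generalize hX : K.basis (Superspace.idx i p) = X
    refine Superspace.ofBasis_induction A.basis (P := fun a => gammaK 0 0 X a * m =
      gammaK l b X (a * m) - koszul i j • (a * gammaK l b X m))
      (fun q => ?_) (fun y y' h h' => ?_) (fun c y h => ?_) ha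
    · subst hX
      induction m using A.induction with
      | ht k =>
        rcases zmod_two_cases i with rfl | rfl <;> rcases zmod_two_cases j with rfl | rfl <;>
          simp only [Superspace.idx_zero, Superspace.idx_one, K.basis_inl, K.basis_inr,
            A.basis_inl, A.basis_inr, t_mul_t, t_mul_tξ, tξ_mul_t, tξ_mul_tξ, gammaK_L_t,
            gammaK_L_tξ, gammaK_G_t, gammaK_G_tξ, mul_smul_comm, smul_mul_assoc, mul_neg, neg_mul,
            map_zero, smul_zero, koszul, smul_smul] <;>
          push_cast <;> ring_nf <;> simp <;> module
      | hξ k =>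
        rcases zmod_two_cases i with rfl | rfl <;> rcases zmod_two_cases j with rfl | rfl <;>
          simp only [Superspace.idx_zero, Superspace.idx_one, K.basis_inl, K.basis_inr,
            A.basis_inl, A.basis_inr, t_mul_t, t_mul_tξ, tξ_mul_t, tξ_mul_tξ, gammaK_L_t,
            gammaK_L_tξ, gammaK_G_t, gammaK_G_tξ, mul_smul_comm, smul_mul_assoc, mul_neg, neg_mul,
            map_zero, smul_zero, koszul, smul_smul] <;>
          push_cast <;> ring_nf <;> simp <;> module
      | hadd x x' h h' =>
        simp only [map_add, mul_add, h, h']; module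
      | hsmul c x h =>
        simp only [map_smul, mul_smul_comm, h]; module
    · simp only [map_add, add_mul, h, h']; module
    · simp only [map_smul, smul_mul_assoc, h]; module
  · simp only [map_add, LinearMap.add_apply, add_mul, mul_add, h, h']; module
  · simp only [map_smul, LinearMap.smul_apply, smul_mul_assoc, mul_smul_comm, h]; module

theorem A.mul_mem {i j : ZMod 2} {x y : A} (hx : x ∈ A.gr.part i) (hy : y ∈ A.gr.part j) :
    x * y ∈ A.gr.part (i + j) := by
  refine Superspace.ofBasis_induction A.basis (P := fun x => x * y ∈ A.gr.part (i + j))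
    (fun n => ?_) (fun x x' h h' => ?_) (fun c x h => ?_) hx
  · refine Superspace.ofBasis_induction A.basis
      (P := fun y => A.basis (Superspace.idx i n) * y ∈ A.gr.part (i + j))
      (fun k => ?_) (fun y y' h h' => ?_) (fun c y h => ?_) hy
    · rcases zmod_two_cases i with rfl | rfl <;> rcases zmod_two_cases j with rfl | rfl <;>
        simp only [Superspace.idx_zero, Superspace.idx_one, A.basis_inl,
          A.basis_inr, t_mul_t, t_mul_tξ, tξ_mul_t, tξ_mul_tξ]
      · exact t_mem _
      · exact tξ_mem _
      · exact tξ_mem _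
      · exact zero_mem _
    · rw [mul_add]; exact add_mem h h'
    · rw [mul_smul_comm]; exact Submodule.smul_mem _ c h
  · rw [add_mul]; exact add_mem h h'
  · rw [smul_mul_assoc]; exact Submodule.smul_mem _ c h

theorem A.mul_super_comm {i j : ZMod 2} {x y : A} (hx : x ∈ A.gr.part i) (hy : y ∈ A.gr.part j) :
    x * y = koszul i j • (y * x) := by
  refine Superspace.ofBasis_induction A.basis (P := fun x => x * y = koszul i j • (y * x))
    (fun n => ?_) (fun x x' h h' => ?_) (fun c x h => ?_) hx
  · refine Superspace.ofBasis_induction A.basis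
      (P := fun y => A.basis (Superspace.idx i n) * y =
        koszul i j • (y * A.basis (Superspace.idx i n)))
      (fun k => ?_) (fun y y' h h' => ?_) (fun c y h => ?_) hy
    · rcases zmod_two_cases i with rfl | rfl <;> rcases zmod_two_cases j with rfl | rfl <;>
        simp only [Superspace.idx_zero, Superspace.idx_one, A.basis_inl,
          A.basis_inr, t_mul_t, t_mul_tξ, tξ_mul_t, tξ_mul_tξ, add_comm n k] <;> simp [koszul]
    · simp only [mul_add, add_mul, h, h', smul_add]
    · simp only [mul_smul_comm, smul_mul_assoc, h, smul_comm c]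
  · simp only [mul_add, add_mul, h, h', smul_add]
  · simp only [mul_smul_comm, smul_mul_assoc, h, smul_comm c]

/-- `A` as a `𝔨`-module. -/
def circModule : SuperModule K A where
  gr := A.gr
  act := circ
  act_mem := fun hx hm => circ_eq ▸ gammaK_mem 0 0 hx hm
  act_brk := fun hx hy m => circ_eq ▸ gammaK_brk 0 0 hx hy m

/-- The extended algebra `𝔨 ⋉ A`. -/
abbrev KA : Type := K × A

instance : LieSuperalgebra KA := semidirect circModule

/-- The `𝔨 ⋉ A`-module `Γ(l, b)`: `A` acts on `A` by multiplication. -/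
def Gamma (l b : ℂ) : SuperModule KA A where
  gr := A.gr
  act := (gammaK l b).coprod (LinearMap.mul ℂ A)
  act_mem := fun hx hm => add_mem (gammaK_mem l b hx.1 hm) (A.mul_mem hx.2 hm)
  act_brk := by
    rintro i j ⟨x, a⟩ ⟨y, c⟩ ⟨hx, ha⟩ ⟨hy, hc⟩ m
    simp only at hx ha hy hc
    change gammaK l b (K.brk x y) m + (circ x c - twist circModule a y) * m =
      (gammaK l b x (gammaK l b y m + c * m) + a * (gammaK l b y m + c * m)) -
        koszul i j • (gammaK l b y (gammaK l b x m + a * m) + c * (gammaK l b x m + a * m))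
    have h : twist circModule a y = koszul i j • circ y a := twist_apply circModule ha hy
    rw [h, sub_mul, smul_mul_assoc, gammaK_brk l b hx hy, gammaK_mul l b hx hc,
      gammaK_mul l b hy ha, mul_add, mul_add, map_add, map_add, ← mul_assoc, ← mul_assoc,
      A.mul_super_comm ha hc, smul_mul_assoc, koszul_comm j i]
    simp only [smul_sub, smul_add, smul_smul, koszul_mul_self]
    module

/-! ### The pairs `(𝔤, 𝒜)` and jet modules -/

/-- A pair consisting of a subalgebra `𝔤` of `𝔨` containing `L_0` and a graded subalgebra `𝒜` of `A`
which is stable under the action of `𝔤`. -/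
structure JetPair where
  lie : LieSubsuperalgebra K
  alg : Subalgebra ℂ A
  L_zero_mem : L 0 ∈ lie.carrier
  isGraded : A.gr.IsGraded (Subalgebra.toSubmodule alg)
  stable : ∀ x ∈ lie.carrier, ∀ a ∈ alg, circ x a ∈ alg

namespace JetPair

/-- The extended algebra `𝔤 ⋉ 𝒜`. -/
def ext (p : JetPair) : LieSubsuperalgebra KA where
  carrier := p.lie.carrier.prod (Subalgebra.toSubmodule p.alg)
  isGraded := by
    rintro ⟨x, a⟩ ⟨hx, ha⟩
    obtain ⟨x0, h0, x1, h1, rfl⟩ := Submodule.mem_sup.1 (p.lie.isGraded hx)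
    obtain ⟨a0, g0, a1, g1, rfl⟩ := Submodule.mem_sup.1 (p.isGraded ha)
    exact Submodule.mem_sup.2 ⟨(x0, a0), ⟨⟨h0.1, g0.1⟩, ⟨h0.2, g0.2⟩⟩,
      (x1, a1), ⟨⟨h1.1, g1.1⟩, ⟨h1.2, g1.2⟩⟩, rfl⟩
  brk_mem := by
    rintro ⟨x, a⟩ ⟨y, c⟩ ⟨hx, ha⟩ ⟨hy, hc⟩
    refine ⟨p.lie.brk_mem hx hy, sub_mem (p.stable x hx c hc) ?_⟩
    simp only [twist, LinearMap.sum_apply, LinearMap.smul_apply, LinearMap.flip_apply,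
      LinearMap.compl₁₂_apply]
    exact sum_mem fun i _ => sum_mem fun j _ => Submodule.smul_mem _ _
      (p.stable _ (p.lie.isGraded.proj_mem hy j) _ (p.isGraded.proj_mem ha i))

/-- The element `L_0` of `𝔤 ⋉ 𝒜`. -/
def L_zero (p : JetPair) : p.ext.carrier := ⟨(L 0, 0), p.L_zero_mem, zero_mem _⟩

/-- The element of `𝔤 ⋉ 𝒜` given by `a ∈ 𝒜`. -/
def ofAlg (p : JetPair) (a : p.alg) : p.ext.carrier := ⟨(0, a), zero_mem _, a.2⟩

variable {M : Type u} [AddCommGroup M] [Module ℂ M]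

/-- The algebra `𝒜` acts associatively (and unitally). -/
def IsAssociative (p : JetPair) (X : SuperModule p.ext.carrier M) : Prop :=
  (∀ m, X.act (p.ofAlg 1) m = m) ∧
    ∀ a b m, X.act (p.ofAlg (a * b)) m = X.act (p.ofAlg a) (X.act (p.ofAlg b) m)

/-- The weight space of weight `μ`, `{v | L_0 v = μ v}`. -/
def weightSpace (p : JetPair) (X : SuperModule p.ext.carrier M) (μ : ℂ) : Submodule ℂ M :=
  Module.End.eigenspace (X.act p.L_zero) μ

/-- A jet module for `(𝔤, 𝒜)`: an `𝒜𝔤`-module, i.e. a `𝔤 ⋉ 𝒜`-module on which `𝒜` acts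
associatively, which is a weight module (`L_0` acts diagonalizably) and for which some weight space
in the support is finite dimensional. -/
structure IsJet (p : JetPair) (X : SuperModule p.ext.carrier M) : Prop where
  isAssociative : p.IsAssociative X
  isWeight : ⨆ μ, p.weightSpace X μ = ⊤
  exists_finite : ∃ μ, p.weightSpace X μ ≠ ⊥ ∧ FiniteDimensional ℂ (p.weightSpace X μ)

end JetPair

theorem isGraded_span {V : Type u} [AddCommGroup V] [Module ℂ V] (S : Superspace V) {s : Set V}
    (hs : ∀ x ∈ s, ∃ i, x ∈ S.part i) : S.IsGraded (Submodule.span ℂ s) := by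
  refine Submodule.span_le.2 fun x hx => ?_
  obtain ⟨i, hi⟩ := hs x hx
  have h : x ∈ Submodule.span ℂ s := Submodule.subset_span hx
  rcases zmod_two_cases i with rfl | rfl
  · exact Submodule.mem_sup_left ⟨h, hi⟩
  · exact Submodule.mem_sup_right ⟨h, hi⟩

theorem isGraded_top {V : Type u} [AddCommGroup V] [Module ℂ V] (S : Superspace V) :
    S.IsGraded ⊤ := by
  simp [Superspace.IsGraded, S.isCompl.sup_eq_top]

/-- `𝔨` as a subalgebra of itself. -/
def Kfull : LieSubsuperalgebra K where
  carrier := ⊤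
  isGraded := isGraded_top _
  brk_mem := fun _ _ => trivial

/-- The contact subalgebra `𝔨⁺`, spanned by the `L_n` with `n ≥ -1` and the `G_r` with
`r ≥ -1/2`. -/
def Kplus : LieSubsuperalgebra K where
  carrier := Submodule.span ℂ (L '' Set.Ici (-1) ∪ G '' Set.Ici (-1))
  isGraded := by
    refine isGraded_span _ ?_
    rintro _ (⟨n, -, rfl⟩ | ⟨n, -, rfl⟩)
    exacts [⟨0, L_mem n⟩, ⟨1, G_mem n⟩]
  brk_mem := by
    intro x y hx hy
    have hL : ∀ (c : ℂ) (n : ℤ), (n < -1 → c = 0) →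
        c • L n ∈ Submodule.span ℂ (L '' Set.Ici (-1) ∪ G '' Set.Ici (-1)) := by
      intro c n h
      rcases lt_or_ge n (-1) with h' | h'
      · rw [h h', zero_smul]; exact zero_mem _
      · exact Submodule.smul_mem _ _ (Submodule.subset_span (Or.inl ⟨n, h', rfl⟩))
    have hG : ∀ (c : ℂ) (n : ℤ), (n < -1 → c = 0) →
        c • G n ∈ Submodule.span ℂ (L '' Set.Ici (-1) ∪ G '' Set.Ici (-1)) := by
      intro c n h
      rcases lt_or_ge n (-1) with h' | h'
      · rw [h h', zero_smul]; exact zero_mem _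
      · exact Submodule.smul_mem _ _ (Submodule.subset_span (Or.inr ⟨n, h', rfl⟩))
    change K.brk x y ∈ _
    refine Submodule.span_induction₂ (p := fun x y _ _ => K.brk x y ∈ Submodule.span ℂ
      (L '' Set.Ici (-1) ∪ G '' Set.Ici (-1))) ?_ ?_ ?_ ?_ ?_ ?_ ?_ hx hy
    · rintro _ _ (⟨m, hm, rfl⟩ | ⟨m, hm, rfl⟩) (⟨n, hn, rfl⟩ | ⟨n, hn, rfl⟩) <;>
        simp only [Set.mem_Ici] at hm hn
      · rw [K.brk_LL]
        refine hL _ _ fun h => ?_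
        obtain ⟨rfl, rfl⟩ : m = -1 ∧ n = -1 := by omega
        norm_num
      · rw [K.brk_LG]
        refine hG _ _ fun h => ?_
        obtain ⟨rfl, rfl⟩ : m = -1 ∧ n = -1 := by omega
        norm_num
      · rw [K.brk_GL]
        refine neg_mem (hG _ _ fun h => ?_)
        obtain ⟨rfl, rfl⟩ : m = -1 ∧ n = -1 := by omega
        norm_num
      · rw [K.brk_GG]
        exact hL _ _ fun h => by omega
    · intros; simp
    · intros; simp
    · intro _ _ _ _ _ _ h h'; simpa using add_mem h h'
    · intro _ _ _ _ _ _ h h'; simpa using add_mem h h'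
    · intro c _ _ _ _ h; simpa using Submodule.smul_mem _ c h
    · intro c _ _ _ _ h; simpa using Submodule.smul_mem _ c h

/-- The subspace `ℂ[t] ⊗ Λ(1)` of `A`, spanned by the `t^n` and `t^n ξ` with `n ≥ 0`. -/
def AplusSpace : Submodule ℂ A :=
  Submodule.span ℂ (t '' Set.Ici 0 ∪ (fun n => t n * ξ) '' Set.Ici 0)

theorem t_mem_Aplus {n : ℤ} (hn : 0 ≤ n) : t n ∈ AplusSpace :=
  Submodule.subset_span (Or.inl ⟨n, hn, rfl⟩)

theorem tξ_mem_Aplus {n : ℤ} (hn : 0 ≤ n) : t n * ξ ∈ AplusSpace :=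
  Submodule.subset_span (Or.inr ⟨n, hn, rfl⟩)

/-- The subalgebra `A⁺ = ℂ[t] ⊗ Λ(1)` of `A`. -/
def Aplus : Subalgebra ℂ A := AplusSpace.toSubalgebra (t_mem_Aplus le_rfl) (by
  intro x y hx hy
  refine Submodule.span_induction₂ (p := fun x y _ _ => x * y ∈ AplusSpace)
    ?_ ?_ ?_ ?_ ?_ ?_ ?_ hx hy
  · rintro _ _ (⟨m, hm, rfl⟩ | ⟨m, hm, rfl⟩) (⟨n, hn, rfl⟩ | ⟨n, hn, rfl⟩)
    · rw [t_mul_t]; exact t_mem_Aplus (add_nonneg hm hn)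
    · rw [t_mul_tξ]; exact tξ_mem_Aplus (add_nonneg hm hn)
    · rw [tξ_mul_t]; exact tξ_mem_Aplus (add_nonneg hm hn)
    · rw [tξ_mul_tξ]; exact zero_mem _
  · intros; simp
  · intros; simp
  · intro _ _ _ _ _ _ h h'; simpa [add_mul] using add_mem h h'
  · intro _ _ _ _ _ _ h h'; simpa [mul_add] using add_mem h h'
  · intro c _ _ _ _ h; simpa using Submodule.smul_mem _ c h
  · intro c _ _ _ _ h; simpa using Submodule.smul_mem _ c h)

theorem Aplus_isGraded : A.gr.IsGraded (Subalgebra.toSubmodule Aplus) := by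
  refine isGraded_span _ ?_
  rintro _ (⟨n, -, rfl⟩ | ⟨n, -, rfl⟩)
  exacts [⟨0, t_mem n⟩, ⟨1, tξ_mem n⟩]

theorem gammaK_mem_Aplus (b : ℂ) {x : K} (hx : x ∈ Kplus.carrier) {a : A} (ha : a ∈ Aplus) :
    gammaK 0 b x a ∈ Aplus := by
  refine Submodule.span_induction₂ (p := fun x a _ _ => gammaK 0 b x a ∈ AplusSpace)
    ?_ ?_ ?_ ?_ ?_ ?_ ?_ hx ha
  · have ht : ∀ (c : ℂ) (n : ℤ), (n < 0 → c = 0) → c • t n ∈ AplusSpace := by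
      intro c n h
      rcases lt_or_ge n 0 with h' | h'
      · rw [h h', zero_smul]; exact zero_mem _
      · exact Submodule.smul_mem _ _ (t_mem_Aplus h')
    have hξ : ∀ (c : ℂ) (n : ℤ), (n < 0 → c = 0) → c • (t n * ξ) ∈ AplusSpace := by
      intro c n h
      rcases lt_or_ge n 0 with h' | h'
      · rw [h h', zero_smul]; exact zero_mem _
      · exact Submodule.smul_mem _ _ (tξ_mem_Aplus h')
    rintro _ _ (⟨m, hm, rfl⟩ | ⟨m, hm, rfl⟩) (⟨n, hn, rfl⟩ | ⟨n, hn, rfl⟩) <;>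
        simp only [Set.mem_Ici] at hm hn
    · rw [gammaK_L_t]
      refine ht _ _ fun h => ?_
      obtain ⟨rfl, rfl⟩ : m = -1 ∧ n = 0 := by omega
      norm_num
    · rw [gammaK_L_tξ]
      refine hξ _ _ fun h => ?_
      obtain ⟨rfl, rfl⟩ : m = -1 ∧ n = 0 := by omega
      norm_num
    · rw [gammaK_G_t]
      refine hξ _ _ fun h => ?_
      obtain ⟨rfl, rfl⟩ : m = -1 ∧ n = 0 := by omega
      norm_num
    · rw [gammaK_G_tξ]
      exact neg_mem (t_mem_Aplus (by omega))
  · intros; simp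
  · intros; simp
  · intro _ _ _ _ _ _ h h'; simpa using add_mem h h'
  · intro _ _ _ _ _ _ h h'; simpa using add_mem h h'
  · intro c _ _ _ _ h; simpa using Submodule.smul_mem _ c h
  · intro c _ _ _ _ h; simpa using Submodule.smul_mem _ c h

/-- The pair `(𝔨, A)`. -/
def pairKA : JetPair where
  lie := Kfull
  alg := ⊤
  L_zero_mem := trivial
  isGraded := isGraded_top _
  stable := fun _ _ _ _ => trivial

/-- The pair `(𝔨⁺, A)`. -/
def pairKplusA : JetPair where
  lie := Kplus
  alg := ⊤
  L_zero_mem := Submodule.subset_span (Or.inl ⟨0, by norm_num, rfl⟩)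
  isGraded := isGraded_top _
  stable := fun _ _ _ _ => trivial

/-- The pair `(𝔨⁺, A⁺)`. -/
def pairKplusAplus : JetPair where
  lie := Kplus
  alg := Aplus
  L_zero_mem := Submodule.subset_span (Or.inl ⟨0, by norm_num, rfl⟩)
  isGraded := Aplus_isGraded
  stable := fun _ hx _ ha => circ_eq ▸ gammaK_mem_Aplus 0 hx ha

/-- `A⁺` is a submodule of `Γ(0, b)` over `𝔨⁺ ⋉ A⁺`. -/
theorem Aplus_isSubmodule (b : ℂ) : ((Gamma 0 b).restrict pairKplusAplus.ext).IsSubmodule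
    (Subalgebra.toSubmodule Aplus) where
  isGraded := Aplus_isGraded
  act_mem := fun x _ hm => add_mem (gammaK_mem_Aplus b x.2.1 hm) (Aplus.mul_mem x.2.2 hm)

/-- The submodule `Γ⁺(0, b) = A⁺` of `Γ(0, b)`. -/
def GammaPlus (b : ℂ) :
    SuperModule pairKplusAplus.ext.carrier (Subalgebra.toSubmodule Aplus) :=
  ((Gamma 0 b).restrict pairKplusAplus.ext).sub _ (Aplus_isSubmodule b)

/-- The quotient `Γ⁻(0, b) = Γ(0, b) / Γ⁺(0, b)`. -/
def GammaMinus (b : ℂ) :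
    SuperModule pairKplusAplus.ext.carrier (A ⧸ Subalgebra.toSubmodule Aplus) :=
  ((Gamma 0 b).restrict pairKplusAplus.ext).quot _ (Aplus_isSubmodule b)

end NeveuSchwarz

end

/-!
Write `∂_t = L_{-1}` and `∂_ξ = ξ L_{-1} - G_{-1/2}`. On an `𝒜𝔤`-module these operators satisfy,
together with `t` and `ξ`, the relations of the Weyl superalgebra, and the operator
`H = L_0 - t ∂_t - (1/2) ξ ∂_ξ` commutes with all four of them. On `Γ(λ, b)` it is the scalar `b`.
The remaining information about the action of `𝔨⁺` is contained in the operators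
`P n = ξ (G_{n+1/2} - t^{n+1} G_{-1/2})` and `Z n = L_n - t^n ((n + 1) L_0 - n t L_{-1})`, which
vanish on `Γ(λ, b)`. The commutation relations `ContactRep.H_P` and `ContactRep.H_Z` say that, in a
triangular sense, they raise the eigenvalues of `H` by positive half-integers. Hence they annihilate
every eigenvector of `H` whose eigenvalue `b` is such that `b + 1/2, b + 1, …` are not eigenvalues
in the weights concerned (`ContactRep.NoHigher`).

Such a `b` exists. The operator `H` preserves the finite dimensional weight space, and so has an
eigenvector there. Over `(𝔨⁺, A⁺)` any of its eigenvalues will do: the vectors annihilated by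
products of factors `H - c` with `c ∈ b + {1/2, 1, …}` form a submodule which does not contain the
eigenvectors for `b`, and this submodule is zero by simplicity (`ContactRep.IsIrreducible.noHigher`).
If `t` is invertible, all weight spaces in the relevant cosets are finite dimensional, and an
eigenvalue with maximal real part is taken (`ContactRep.exists_isVacuum_of_invertible`).

Replacing the eigenvector `u` by a homogeneous component of it or by the image of this component
under `∂_ξ` yields a vacuum vector `v` with `∂_ξ v = 0` and `t ∂_t v = λ v`. Multiplying by powers of
`t` and applying powers of `∂_t` gives a chain of vectors on which `t`, `∂_t` and `L_0` act as on the
powers of `t` in `Γ(λ, b)`, and by the vanishing of `Z n` so does all of `𝔨⁺`; the action of the odd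
generators follows from that of `G_{-1/2}` and of the `L_n` (`ContactRep.IsChain.isGammaFamily`).
For `t` not invertible and `λ ∈ ℤ`, the vacuum vector can be chosen to be annihilated by `∂_t` or by
`t`, which leads to `Γ⁺` and `Γ⁻` (`ContactRep.IsVacuum.exists_isChain_trichotomy`).

For `𝔨` there remain the `L_n` with `n ≤ -2`. The vectors `z_n = t^{-n} L_n v - (λ + b (n + 1)) v`
lie in one finite dimensional weight space, and those with `-m - 1 ≤ n ≤ -2` are eigenvectors of
`t^{-m} L_m` for distinct eigenvalues; hence some `z_{-k}` vanishes, and from this follows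
`z_{-2} = 0` (`ContactRep.defect_neg_two`).

So there is a homomorphism, up to parity, from `Γ(λ, b)`, `Γ⁺(0, b)` or `Γ⁻(0, b)` to the given
module. It is surjective by simplicity, and injective because the basis vectors are mapped to nonzero
vectors of distinct weights.
-/

noncomputable section

namespace NeveuSchwarz

open Module

universe u v w

/-! ### Representations by contact operators -/

/-- A representation of contact type on a complex superspace `M`: operators `T k`, `ξ`, `L n`,
`G n` standing for the actions of `t ^ k`, `ξ`, `L_n` and `G_{n + 1/2}`, subject to the relations of
`𝔨 ⋉ A` and to the associativity of the action of `A`. The relations are only imposed for the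
indices `n` of `L`, `G` in `I` and the exponents `k` of `t` in `J`; the other operators are
unconstrained. -/
structure ContactRep (I J : ℤ → Prop) (M : Type u) [AddCommGroup M] [Module ℂ M] where
  gr : Superspace M
  T : ℤ → End ℂ M
  ξ : End ℂ M
  L : ℤ → End ℂ M
  G : ℤ → End ℂ M
  T_mem : ∀ k i x, x ∈ gr.part i → T k x ∈ gr.part i
  ξ_mem : ∀ i x, x ∈ gr.part i → ξ x ∈ gr.part (i + 1)
  L_mem : ∀ n i x, x ∈ gr.part i → L n x ∈ gr.part i
  G_mem : ∀ n i x, x ∈ gr.part i → G n x ∈ gr.part (i + 1)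
  T_zero : ∀ x, T 0 x = x
  T_T : ∀ j k, J j → J k → ∀ x, T j (T k x) = T (j + k) x
  ξ_T : ∀ k, J k → ∀ x, ξ (T k x) = T k (ξ x)
  ξ_ξ : ∀ x, ξ (ξ x) = 0
  L_L : ∀ m n, I m → I n → ∀ x, L m (L n x) = L n (L m x) + ((n : ℂ) - m) • L (m + n) x
  L_G : ∀ m n, I m → I n → ∀ x,
    L m (G n x) = G n (L m x) + ((n : ℂ) + 1 / 2 - m / 2) • G (m + n) x
  G_G : ∀ m n, I m → I n → ∀ x, G m (G n x) = -G n (G m x) - (2 : ℂ) • L (m + n + 1) x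
  L_T : ∀ n k, I n → J k → ∀ x, L n (T k x) = T k (L n x) + (k : ℂ) • T (n + k) x
  L_ξ : ∀ n, I n → ∀ x, L n (ξ x) = ξ (L n x) + (((n : ℂ) + 1) / 2) • T n (ξ x)
  G_T : ∀ n k, I n → J k → ∀ x, G n (T k x) = T k (G n x) + (k : ℂ) • T (n + k) (ξ x)
  G_ξ : ∀ n, I n → ∀ x, G n (ξ x) = -ξ (G n x) - T (n + 1) x

namespace ContactRep

variable {M : Type u} [AddCommGroup M] [Module ℂ M]

/-- Forgetting some of the relations. -/
def mono {I J I' J' : ℤ → Prop} (R : ContactRep I J M) (hI : ∀ n, I' n → I n)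
    (hJ : ∀ k, J' k → J k) : ContactRep I' J' M where
  gr := R.gr
  T := R.T
  ξ := R.ξ
  L := R.L
  G := R.G
  T_mem := R.T_mem
  ξ_mem := R.ξ_mem
  L_mem := R.L_mem
  G_mem := R.G_mem
  T_zero := R.T_zero
  T_T j k hj hk := R.T_T j k (hJ j hj) (hJ k hk)
  ξ_T k hk := R.ξ_T k (hJ k hk)
  ξ_ξ := R.ξ_ξ
  L_L m n hm hn := R.L_L m n (hI m hm) (hI n hn)
  L_G m n hm hn := R.L_G m n (hI m hm) (hI n hn)
  G_G m n hm hn := R.G_G m n (hI m hm) (hI n hn)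
  L_T n k hn hk := R.L_T n k (hI n hn) (hJ k hk)
  L_ξ n hn := R.L_ξ n (hI n hn)
  G_T n k hn hk := R.G_T n k (hI n hn) (hJ k hk)
  G_ξ n hn := R.G_ξ n (hI n hn)

variable (R : ContactRep (-1 ≤ ·) (0 ≤ ·) M)

/-! ### The operator `H` and its commutation relations -/

/-- The operator `∂/∂ξ = ξ L_{-1} - G_{-1/2}`. -/
def d : End ℂ M := R.ξ ∘ₗ R.L (-1) - R.G (-1)

/-- The operator `L_0 - t ∂/∂t - (1/2) ξ ∂/∂ξ`, where `∂/∂t = L_{-1}`; since `ξ² = 0`, it equals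
`L_0 - t L_{-1} + (1/2) ξ G_{-1/2}`. It acts on `Γ(λ, b)` as the scalar `b`. -/
def H : End ℂ M := R.L 0 - R.T 1 ∘ₗ R.L (-1) + (1 / 2 : ℂ) • (R.ξ ∘ₗ R.G (-1))

theorem d_apply (x : M) : R.d x = R.ξ (R.L (-1) x) - R.G (-1) x := rfl

theorem H_apply (x : M) :
    R.H x = R.L 0 x - R.T 1 (R.L (-1) x) + (1 / 2 : ℂ) • R.ξ (R.G (-1) x) := rfl

theorem L_neg_one_ξ (x : M) : R.L (-1) (R.ξ x) = R.ξ (R.L (-1) x) := by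
  rw [R.L_ξ _ (by omega)]; norm_num

theorem L_zero_ξ (x : M) : R.L 0 (R.ξ x) = R.ξ (R.L 0 x) + (1 / 2 : ℂ) • R.ξ x := by
  rw [R.L_ξ _ (by omega)]; norm_num [R.T_zero]

theorem G_neg_one_ξ (x : M) : R.G (-1) (R.ξ x) = -R.ξ (R.G (-1) x) - x := by
  rw [R.G_ξ _ (by omega)]; norm_num [R.T_zero]

theorem L_neg_one_G (x : M) : R.L (-1) (R.G (-1) x) = R.G (-1) (R.L (-1) x) := by
  rw [R.L_G _ _ (by omega) (by omega)]; norm_num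

theorem G_neg_one_sq (x : M) : R.G (-1) (R.G (-1) x) = -R.L (-1) x := by
  have h := R.G_G (-1) (-1) (by omega) (by omega) x
  have h2 : (2 : ℂ) • R.G (-1) (R.G (-1) x) = (2 : ℂ) • -R.L (-1) x := by
    norm_num at h
    linear_combination (norm := module) h
  exact smul_right_injective M (two_ne_zero' ℂ) h2

theorem d_ξ (x : M) : R.d (R.ξ x) + R.ξ (R.d x) = x := by
  simp only [d_apply, L_neg_one_ξ, G_neg_one_ξ, map_sub, R.ξ_ξ]
  abel

theorem d_d (x : M) : R.d (R.d x) = 0 := by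
  simp only [d_apply, map_sub, L_neg_one_ξ, L_neg_one_G, G_neg_one_ξ, G_neg_one_sq, R.ξ_ξ]
  abel

theorem H_T (k : ℤ) (hk : 0 ≤ k) (x : M) : R.H (R.T k x) = R.T k (R.H x) := by
  simp (disch := omega) only [H_apply, R.L_T, R.G_T, R.T_T, R.ξ_T, map_add, map_sub,
    map_smul]
  rcases hk.eq_or_lt with rfl | hk
  · simp
  simp (disch := omega) only [R.T_T, R.ξ_T, R.ξ_ξ, map_zero]
  ring_nf
  module

theorem H_ξ (x : M) : R.H (R.ξ x) = R.ξ (R.H x) := by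
  simp (disch := omega) only [H_apply, L_zero_ξ, L_neg_one_ξ, G_neg_one_ξ, R.ξ_T, R.ξ_ξ, map_add,
    map_sub, map_smul, map_neg]
  module

theorem H_L_neg_one (x : M) : R.H (R.L (-1) x) = R.L (-1) (R.H x) := by
  simp (disch := omega) only [H_apply, R.L_T, L_neg_one_ξ, L_neg_one_G, R.L_L (-1) 0,
    map_add, map_sub, map_smul]
  norm_num [R.T_zero]

theorem H_G_neg_one (x : M) : R.H (R.G (-1) x) = R.G (-1) (R.H x) := by
  simp (disch := omega) only [H_apply, R.G_T, L_neg_one_G, G_neg_one_ξ, G_neg_one_sq,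
    R.L_G 0 (-1), map_add, map_sub, map_smul, map_neg]
  norm_num [R.T_zero]
  module

theorem H_L_zero (x : M) : R.H (R.L 0 x) = R.L 0 (R.H x) := by
  simp (disch := omega) only [H_apply, R.L_T, L_zero_ξ, R.L_L 0 (-1), R.L_G 0 (-1),
    map_add, map_sub, map_smul]
  norm_num

theorem H_d (x : M) : R.H (R.d x) = R.d (R.H x) := by
  simp only [d_apply, map_sub, H_ξ, H_L_neg_one, H_G_neg_one]

/-- The defect of the identity `ξ G_{n+1/2} = t^{n+1} ξ G_{-1/2}`, which holds in `Γ(λ, b)`. -/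
def P (n : ℤ) : End ℂ M := R.ξ ∘ₗ (R.G n - R.T (n + 1) ∘ₗ R.G (-1))

theorem P_apply (n : ℤ) (x : M) : R.P n x = R.ξ (R.G n x - R.T (n + 1) (R.G (-1) x)) := rfl

theorem P_neg_one (x : M) : R.P (-1) x = 0 := by simp [P_apply, R.T_zero]

/-- The defect of the identity `L_n = t^n ((n + 1) L_0 - n t L_{-1})`, which holds in
`Γ(λ, b)`. -/
def Z (n : ℤ) : End ℂ M :=
  R.L n - R.T n ∘ₗ (((n : ℂ) + 1) • R.L 0 - (n : ℂ) • (R.T 1 ∘ₗ R.L (-1)))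

theorem Z_apply (n : ℤ) (x : M) :
    R.Z n x = R.L n x - R.T n (((n : ℂ) + 1) • R.L 0 x - (n : ℂ) • R.T 1 (R.L (-1) x)) := rfl

theorem Z_zero (x : M) : R.Z 0 x = 0 := by simp [Z_apply, R.T_zero]

/-- Modulo `P (n - 1)`, the operator `P n` raises the eigenvalues of `H` by `n + 1/2`. -/
theorem H_P (n : ℤ) (hn : 0 ≤ n) (x : M) : R.H (R.P n x) =
    R.P n (R.H x) + ((n : ℂ) + 1 / 2) • R.P n x - ((n : ℂ) + 1) • R.T 1 (R.P (n - 1) x) := by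
  simp (disch := omega) only [P_apply, map_sub, H_ξ, H_T, H_G_neg_one]
  simp (disch := omega) only [H_apply, R.L_G 0, R.L_G (-1) n, R.ξ_T, R.ξ_ξ, R.G_T,
    R.G_ξ, R.T_T, map_add, map_sub, map_smul, map_neg, G_neg_one_sq]
  push_cast
  ring_nf
  simp only [map_zero]
  module

/-- Modulo `Z (n - 1)` and `P (n - 1)`, the operator `Z n` raises the eigenvalues of `H` by `n`. -/
theorem H_Z (n : ℤ) (hn : 1 ≤ n) (x : M) : R.H (R.Z n x) = R.Z n (R.H x) + (n : ℂ) • R.Z n x -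
    ((n : ℂ) + 1) • R.T 1 (R.Z (n - 1) x) + (((n : ℂ) + 1) / 4) • R.P (n - 1) x := by
  simp (disch := omega) only [Z_apply, map_sub, map_smul, H_T, H_L_zero, H_L_neg_one]
  simp (disch := omega) only [P_apply, H_apply, R.L_L 0 n, R.L_L (-1) n, R.L_G n (-1), R.L_ξ n,
    R.L_T, R.T_T, R.ξ_T, R.L_L (-1) 0, map_add, map_sub, map_smul, L_zero_ξ, L_neg_one_ξ,
    L_neg_one_G, R.L_G 0 (-1)]
  push_cast
  ring_nf
  module
end ContactRep

namespace ContactRep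

variable {M : Type u} [AddCommGroup M] [Module ℂ M]

/-! ### Families transforming like the powers of `t` -/

section Family

variable {I J : ℤ → Prop} (R : ContactRep I J M)

/-- The vectors `e k`, `S k`, are multiplied by the powers `t^j`, `J j`, and acted on by the
operators `L n`, `G n`, `I n`, like the vectors `t^k` of `Γ(l, b)`. -/
structure IsGammaFamily (S : ℤ → Prop) (l b : ℂ) (e : ℤ → M) : Prop where
  T_e : ∀ j k, J j → S k → R.T j (e k) = e (j + k)
  L_e : ∀ n k, I n → S k → R.L n (e k) = (l + k + b * (n + 1)) • e (n + k)
  G_e : ∀ n k, I n → S k → R.G n (e k) = (k + l + 2 * b * (n + 1)) • R.ξ (e (n + k))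

variable {R}

theorem L_ξ_of_L {l b : ℂ} {e : ℤ → M} {n k : ℤ} (hn : I n)
    (hT : n = -1 ∨ J n ∧ R.T n (e k) = e (n + k))
    (hL : R.L n (e k) = (l + k + b * (n + 1)) • e (n + k)) :
    R.L n (R.ξ (e k)) = (l + k + (n + 1) * (b + 1 / 2)) • R.ξ (e (n + k)) := by
  rw [R.L_ξ n hn, hL]
  rcases hT with rfl | ⟨hJ, hT⟩
  · norm_num
  · rw [← R.ξ_T n hJ, hT, map_smul]
    module

/-- The action of `G_{n+1/2}` is determined by that of `L_{n+1}` and `G_{-1/2}`, since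
`[L_{n+1}, G_{-1/2}]` is a nonzero multiple of `G_{n+1/2}` for `n ≠ -2`. -/
theorem G_of_L {l b : ℂ} {e : ℤ → M} {n k : ℤ} (hn2 : n ≠ -2) (hn : I (n + 1)) (hI : I (-1))
    (hL : R.L (n + 1) (e k) = (l + k + b * ((n + 1 : ℤ) + 1)) • e (n + 1 + k))
    (hLξ : l + k = 0 ∨ R.L (n + 1) (R.ξ (e (k - 1))) =
      (l + (k - 1 : ℤ) + ((n + 1 : ℤ) + 1) * (b + 1 / 2)) • R.ξ (e (n + 1 + (k - 1))))
    (hG : R.G (-1) (e k) = (l + k) • R.ξ (e (k - 1)))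
    (hG' : R.G (-1) (e (n + 1 + k)) = (l + (n + 1 + k : ℤ)) • R.ξ (e (n + 1 + k - 1))) :
    R.G n (e k) = (k + l + 2 * b * (n + 1)) • R.ξ (e (n + k)) := by
  have h := R.L_G (n + 1) (-1) hn hI (e k)
  have hξ : R.L (n + 1) ((l + k) • R.ξ (e (k - 1))) = (l + (k : ℂ)) •
      (l + (k - 1 : ℤ) + ((n + 1 : ℤ) + 1) * (b + 1 / 2)) • R.ξ (e (n + k)) := by
    rcases hLξ with h0 | h0
    · rw [h0]; simp
    · rw [map_smul, h0, show n + 1 + (k - 1) = n + k by ring]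
  rw [hG, hL, hξ, map_smul, hG',
    show n + 1 + k - 1 = n + k by ring, show n + 1 + -1 = n by ring] at h
  have hc : ((n : ℂ) + 2) ≠ 0 := by
    have : ((n + 2 : ℤ) : ℂ) ≠ 0 := Int.cast_ne_zero.2 (by omega)
    exact_mod_cast this
  have h3 : ((n : ℂ) + 2) • R.G n (e k) =
      ((n : ℂ) + 2) • (k + l + 2 * b * (n + 1)) • R.ξ (e (n + k)) := by
    push_cast at h
    linear_combination (norm := module) (2 : ℂ) • h
  exact smul_right_injective M hc h3

end Family

variable (R : ContactRep (-1 ≤ ·) (0 ≤ ·) M)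

/-- No vector whose weight lies in `ν + ℤ` is an eigenvector of `H` with an eigenvalue in
`b + {1/2, 1, 3/2, …}`. -/
def NoHigher (b ν : ℂ) : Prop := ∀ (j : ℕ) (k : ℤ) (x : M), R.L 0 x = (ν + k) • x →
  R.H x = (b + ((j : ℂ) + 1) / 2) • x → x = 0

variable {R}

/-- By induction on `n`, the vector `P n u` is an eigenvector of `H` with eigenvalue
`b + n + 1/2`. -/
theorem NoHigher.P_eq_zero {b ν : ℂ} (h : R.NoHigher b ν) {u : M} {k : ℤ}
    (hL : R.L 0 u = (ν + k) • u) (hH : R.H u = b • u) {n : ℤ} (hn : -1 ≤ n) : R.P n u = 0 := by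
  induction n, hn using Int.leInduction with
  | base => exact R.P_neg_one u
  | succ n hn ih =>
    refine h (2 * (n + 1).toNat) (k + (n + 2)) _ ?_ ?_
    · simp (disch := omega) only [P_apply, map_sub, L_zero_ξ, R.L_G 0, R.L_T, hL, map_smul, map_add]
      push_cast
      ring_nf
      module
    · rw [R.H_P _ (by omega), show n + 1 - 1 = n by ring, ih, hH]
      have : (((2 * (n + 1).toNat : ℕ) : ℤ) : ℂ) = ((2 * (n + 1) : ℤ) : ℂ) := by
        congr 1; omega
      push_cast at this
      push_cast
      rw [this, map_smul, map_zero]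
      module

/-- By induction on `n`, the vector `Z n u` is an eigenvector of `H` with eigenvalue `b + n`. -/
theorem NoHigher.Z_eq_zero {b ν : ℂ} (h : R.NoHigher b ν) {u : M} {k : ℤ}
    (hL : R.L 0 u = (ν + k) • u) (hH : R.H u = b • u) {n : ℤ} (hn : 0 ≤ n) : R.Z n u = 0 := by
  induction n, hn using Int.leInduction with
  | base => exact R.Z_zero u
  | succ n hn ih =>
    refine h (2 * n.toNat + 1) (k + (n + 1)) _ ?_ ?_
    · simp (disch := omega) only [Z_apply, map_sub, R.L_L 0 (n + 1), R.L_L 0 (-1), R.L_T, hL,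
        map_smul, map_add]
      push_cast
      ring_nf
      module
    · rw [R.H_Z _ (by omega), show n + 1 - 1 = n by ring, ih, hH,
        h.P_eq_zero hL hH (by omega)]
      have : (((2 * n.toNat + 1 : ℕ) : ℤ) : ℂ) = ((2 * n + 1 : ℤ) : ℂ) := by
        congr 1; omega
      push_cast at this
      push_cast
      rw [this, map_smul, map_zero]
      module

variable (R)

/-- Vectors `e k`, `S k`, annihilated by `∂/∂ξ`, on which `t`, `∂/∂t = L_{-1}` and `L_0` act as on
the powers of `t` in `Γ(l, b)`. The range `S` of `k` has to be stable under the steps which these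
operators can take. -/
structure IsChain (S : ℤ → Prop) (l b : ℂ) (e : ℤ → M) : Prop where
  succ : ∀ k, S k → S (k + 1)
  pred : ∀ k : ℤ, S k → l + k = 0 ∨ S (k - 1)
  T_one : ∀ k, S k → R.T 1 (e k) = e (k + 1)
  L_neg_one : ∀ k : ℤ, S k → R.L (-1) (e k) = (l + k) • e (k - 1)
  L_zero : ∀ k : ℤ, S k → R.L 0 (e k) = (l + b + k) • e k
  d_e : ∀ k, S k → R.d (e k) = 0

variable {R}

namespace IsChain

variable {S : ℤ → Prop} {l b : ℂ} {e : ℤ → M} (he : R.IsChain S l b e)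
include he

theorem add (j k : ℤ) (hj : 0 ≤ j) (hk : S k) : S (j + k) := by
  induction j, hj using Int.leInduction with
  | base => rwa [zero_add]
  | succ j hj ih =>
    rw [add_right_comm]
    exact he.succ _ ih

theorem T_e (j k : ℤ) (hj : 0 ≤ j) (hk : S k) : R.T j (e k) = e (j + k) := by
  induction j, hj using Int.leInduction with
  | base => simp [R.T_zero]
  | succ j hj ih =>
    rw [add_comm j 1, ← R.T_T 1 j (by omega) hj, ih, he.T_one _ (he.add j k hj hk)]
    congr 1; ring

theorem T_one_L_neg_one (k : ℤ) (hk : S k) : R.T 1 (R.L (-1) (e k)) = (l + k) • e k := by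
  rw [he.L_neg_one k hk, map_smul]
  rcases he.pred k hk with h | h
  · simp [h]
  · rw [he.T_one _ h, sub_add_cancel]

theorem G_neg_one (k : ℤ) (hk : S k) : R.G (-1) (e k) = (l + k) • R.ξ (e (k - 1)) := by
  have h := he.d_e k hk
  rw [d_apply, he.L_neg_one k hk, map_smul, sub_eq_zero] at h
  exact h.symm

theorem H_e (k : ℤ) (hk : S k) : R.H (e k) = b • e k := by
  rw [H_apply, he.G_neg_one k hk, he.T_one_L_neg_one k hk, he.L_zero k hk, map_smul, R.ξ_ξ]
  module

theorem L_e (h : R.NoHigher b (l + b)) (n k : ℤ) (hn : -1 ≤ n) (hk : S k) :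
    R.L n (e k) = (l + k + b * (n + 1)) • e (n + k) := by
  rcases hn.eq_or_lt with rfl | hn
  · rw [he.L_neg_one k hk, show -1 + k = k - 1 by ring]; norm_num
  · have hZ := h.Z_eq_zero (he.L_zero k hk) (he.H_e k hk) (n := n) (by omega)
    rw [Z_apply, sub_eq_zero, he.L_zero k hk, he.T_one_L_neg_one k hk] at hZ
    rw [hZ, ← he.T_e n k (by omega) hk, ← map_smul]
    congr 1
    module

/-- In the absence of higher eigenvalues of `H`, a chain is acted on by all of `𝔨⁺` as in
`Γ(l, b)`. -/
theorem isGammaFamily (h : R.NoHigher b (l + b)) : R.IsGammaFamily S l b e where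
  T_e := he.T_e
  L_e := he.L_e h
  G_e n k hn hk := by
    rcases hn.eq_or_lt with rfl | hn
    · rw [he.G_neg_one k hk, show -1 + k = k - 1 by ring]; norm_num [add_comm]
    · have hL := fun k hk => he.L_e h (n + 1) k (by omega) hk
      refine G_of_L (by omega) (by omega) (by omega) (hL k hk) ?_ (he.G_neg_one k hk)
        (he.G_neg_one _ (he.add (n + 1) k (by omega) hk))
      exact (he.pred k hk).imp_right fun hk' => L_ξ_of_L (by omega)
        (Or.inr ⟨by omega, he.T_e _ _ (by omega) hk'⟩) (hL _ hk')

end IsChain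

end ContactRep

/-! ### Irreducible representations -/

namespace Superspace

variable {V : Type u} [AddCommGroup V] [Module ℂ V] (S : Superspace V)

theorem proj_mem_part (i : ZMod 2) (x : V) : S.proj i x ∈ S.part i := by
  have hx : x ∈ S.part 0 ⊔ S.part 1 := by rw [S.isCompl.sup_eq_top]; trivial
  obtain ⟨y, hy, z, hz, rfl⟩ := Submodule.mem_sup.1 hx
  rw [map_add, S.proj_of_mem hy, S.proj_of_mem hz]
  rcases zmod_two_cases i with rfl | rfl <;> simp [hy, hz]

theorem isGraded_of_proj_mem {N : Submodule ℂ V} (h : ∀ i, ∀ x ∈ N, S.proj i x ∈ N) :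
    S.IsGraded N := fun x hx => by
  rw [← S.sum_proj x]
  exact add_mem (Submodule.mem_sup_left ⟨h 0 x hx, S.proj_mem_part 0 x⟩)
    (Submodule.mem_sup_right ⟨h 1 x hx, S.proj_mem_part 1 x⟩)

/-- A linear map shifting the parity by `k` intertwines the projections. -/
theorem map_proj {W : Type v} [AddCommGroup W] [Module ℂ W] (S : Superspace V) (S' : Superspace W)
    (k : ZMod 2) (f : V →ₗ[ℂ] W) (hf : ∀ i x, x ∈ S.part i → f x ∈ S'.part (i + k)) (i : ZMod 2)
    (x : V) : f (S.proj i x) = S'.proj (i + k) (f x) := by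
  have h := S.sum_proj x
  conv_rhs => rw [← h, map_add, map_add, S'.proj_of_mem (hf _ _ (S.proj_mem_part 0 x)),
    S'.proj_of_mem (hf _ _ (S.proj_mem_part 1 x))]
  rcases zmod_two_cases i with rfl | rfl <;> simp

end Superspace

namespace ContactRep

variable {M : Type u} [AddCommGroup M] [Module ℂ M]

/-- A graded subspace stable under the operators of `R` with indices in the given ranges. -/
structure IsStable {I J : ℤ → Prop} (R : ContactRep I J M) (N : Submodule ℂ M) : Prop where
  isGraded : R.gr.IsGraded N
  T_mem : ∀ k, J k → ∀ x ∈ N, R.T k x ∈ N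
  ξ_mem : ∀ x ∈ N, R.ξ x ∈ N
  L_mem : ∀ n, I n → ∀ x ∈ N, R.L n x ∈ N
  G_mem : ∀ n, I n → ∀ x ∈ N, R.G n x ∈ N

/-- There are no stable graded subspaces besides `0` and `M`. -/
def IsIrreducible {I J : ℤ → Prop} (R : ContactRep I J M) : Prop :=
  ∀ N : Submodule ℂ M, R.IsStable N → N = ⊥ ∨ N = ⊤

variable (R : ContactRep (-1 ≤ ·) (0 ≤ ·) M)

theorem H_mem (i : ZMod 2) (x : M) (hx : x ∈ R.gr.part i) : R.H x ∈ R.gr.part i := by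
  have h2 : (i + 1 + 1 : ZMod 2) = i := by
    rcases zmod_two_cases i with rfl | rfl <;> rfl
  have h := R.ξ_mem _ _ (R.G_mem (-1) i x hx)
  rw [h2] at h
  exact add_mem (sub_mem (R.L_mem _ _ _ hx) (R.T_mem _ _ _ (R.L_mem _ _ _ hx)))
    (Submodule.smul_mem _ _ h)

theorem d_mem (i : ZMod 2) (x : M) (hx : x ∈ R.gr.part i) : R.d x ∈ R.gr.part (i + 1) :=
  sub_mem (R.ξ_mem _ _ (R.L_mem _ _ _ hx)) (R.G_mem _ _ _ hx)

theorem H_proj (i : ZMod 2) (x : M) : R.H (R.gr.proj i x) = R.gr.proj i (R.H x) := by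
  simpa using R.gr.map_proj R.gr 0 R.H (by simpa using R.H_mem) i x

theorem L_proj (n : ℤ) (i : ZMod 2) (x : M) :
    R.L n (R.gr.proj i x) = R.gr.proj i (R.L n x) := by
  simpa using R.gr.map_proj R.gr 0 (R.L n) (by simpa using R.L_mem n) i x

/-! ### The part of a module above an eigenvalue -/

/-- The vectors annihilated by a product of factors `H - c` with `c ∈ b + {1/2, 1, 3/2, …}`. -/
inductive IsHigher (b : ℂ) : M → Prop
  | zero : IsHigher b 0
  | step (j : ℕ) (x : M) : IsHigher b (R.H x - (b + ((j : ℂ) + 1) / 2) • x) → IsHigher b x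

variable {R}

namespace IsHigher

variable {b : ℂ}

theorem map {f : End ℂ M} (hf : ∀ x, R.H (f x) = f (R.H x)) {x : M} (hx : R.IsHigher b x) :
    R.IsHigher b (f x) := by
  induction hx with
  | zero => rw [map_zero]; exact zero
  | step j x _ ih =>
    refine step j _ ?_
    rwa [hf, ← map_smul, ← map_sub]

theorem smul (c : ℂ) {x : M} (hx : R.IsHigher b x) : R.IsHigher b (c • x) :=
  hx.map (f := c • LinearMap.id) (by simp)

theorem add {x y : M} (hx : R.IsHigher b x) (hy : R.IsHigher b y) : R.IsHigher b (x + y) := by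
  induction hx generalizing y with
  | zero => rwa [zero_add]
  | step j x _ ih =>
    refine step j _ ?_
    have h := ih (hy.map (f := R.H - (b + ((j : ℂ) + 1) / 2) • LinearMap.id) (by simp))
    convert h using 1
    simp only [map_add, LinearMap.sub_apply, LinearMap.smul_apply, LinearMap.id_apply]
    module

theorem sub {x y : M} (hx : R.IsHigher b x) (hy : R.IsHigher b y) : R.IsHigher b (x - y) := by
  rw [sub_eq_add_neg, ← neg_one_smul ℂ]
  exact hx.add (hy.smul _)

theorem P {n : ℤ} (hn : -1 ≤ n) : ∀ {x : M}, R.IsHigher b x → R.IsHigher b (R.P n x) := by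
  induction n, hn using Int.leInduction with
  | base => intro x _; rw [P_neg_one]; exact zero
  | succ n hn ihn =>
    intro x hx
    induction hx with
    | zero => rw [map_zero]; exact zero
    | step j x hx ih =>
      refine step (j + (2 * n + 3).toNat) _ ?_
      have h := ih.sub (((ihn (step j x hx)).map (f := R.T 1) (R.H_T 1 (by omega))).smul
        ((n : ℂ) + 2))
      convert h using 1
      have hc : (((2 * n + 3).toNat : ℤ) : ℂ) = ((2 * n + 3 : ℤ) : ℂ) := by
        congr 1; omega
      push_cast at hc
      rw [R.H_P _ (by omega), show n + 1 - 1 = n by ring]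
      push_cast
      rw [hc, map_sub, map_smul]
      module

theorem Z {n : ℤ} (hn : 0 ≤ n) : ∀ {x : M}, R.IsHigher b x → R.IsHigher b (R.Z n x) := by
  induction n, hn using Int.leInduction with
  | base => intro x _; rw [Z_zero]; exact zero
  | succ n hn ihn =>
    intro x hx
    induction hx with
    | zero => rw [map_zero]; exact zero
    | step j x hx ih =>
      refine step (j + (2 * n + 2).toNat) _ ?_
      have hx' := step j x hx
      have h := (ih.sub (((ihn hx').map (f := R.T 1) (R.H_T 1 (by omega))).smul
        ((n : ℂ) + 2))).add ((hx'.P (n := n) (by omega)).smul (((n : ℂ) + 2) / 4))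
      convert h using 1
      have hc : (((2 * n + 2).toNat : ℤ) : ℂ) = ((2 * n + 2 : ℤ) : ℂ) := by
        congr 1; omega
      push_cast at hc
      rw [R.H_Z _ (by omega), show n + 1 - 1 = n by ring]
      push_cast
      rw [hc, map_sub, map_smul]
      module

theorem L {n : ℤ} (hn : -1 ≤ n) {x : M} (hx : R.IsHigher b x) : R.IsHigher b (R.L n x) := by
  rcases hn.eq_or_lt with rfl | hn
  · exact hx.map R.H_L_neg_one
  · have h := R.Z_apply n x
    rw [eq_sub_iff_add_eq] at h
    rw [← h]
    exact (hx.Z (by omega)).add ((((hx.map R.H_L_zero).smul _).sub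
      (((hx.map R.H_L_neg_one).map (R.H_T 1 (by omega))).smul _)).map (R.H_T n (by omega)))

theorem G {n : ℤ} (hn : -1 ≤ n) {x : M} (hx : R.IsHigher b x) : R.IsHigher b (R.G n x) := by
  rcases hn.eq_or_lt with rfl | hn
  · exact hx.map R.H_G_neg_one
  · have h := R.L_G (n + 1) (-1) (by omega) (by omega) x
    rw [← sub_eq_iff_eq_add', show n + 1 + -1 = n by ring] at h
    have hc : ((n : ℂ) + 2) ≠ 0 := by
      have : ((n + 2 : ℤ) : ℂ) ≠ 0 := Int.cast_ne_zero.2 (by omega)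
      exact_mod_cast this
    have h2 : R.G n x = (-2 / ((n : ℂ) + 2)) •
        (R.L (n + 1) (R.G (-1) x) - R.G (-1) (R.L (n + 1) x)) := by
      rw [h, smul_smul]
      push_cast
      rw [show -2 / ((n : ℂ) + 2) * (-1 + 1 / 2 - (n + 1) / 2) = 1 by field_simp; ring, one_smul]
    rw [h2]
    exact (((hx.map R.H_G_neg_one).L (by omega)).sub
      ((hx.L (by omega)).map R.H_G_neg_one)).smul _

/-- The factors `H - c` act on the eigenspace of `b` as nonzero scalars. -/
theorem eq_zero {x : M} (hx : R.IsHigher b x) (hH : R.H x = b • x) : x = 0 := by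
  induction hx with
  | zero => rfl
  | step j x _ ih =>
    rw [hH, ← sub_smul] at ih
    have h := ih (by rw [map_smul, hH, smul_comm])
    refine (smul_eq_zero.1 h).resolve_left ?_
    have : ((j : ℂ) + 1) ≠ 0 := Nat.cast_add_one_ne_zero j
    intro h0
    apply this
    linear_combination (-2) * h0

end IsHigher

/-- The eigenvectors of `H` with eigenvalue `b` lie outside the stable subspace of the vectors
above `b`, which therefore vanishes if the representation is irreducible. -/
theorem IsIrreducible.noHigher (hR : R.IsIrreducible) {b : ℂ} {u : M} (hu : u ≠ 0)
    (hH : R.H u = b • u) (ν : ℂ) : R.NoHigher b ν := by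
  let N : Submodule ℂ M :=
    { carrier := {x | R.IsHigher b x}
      zero_mem' := IsHigher.zero
      add_mem' := IsHigher.add
      smul_mem' := fun c _ => IsHigher.smul c }
  have hN : R.IsStable N :=
    { isGraded := R.gr.isGraded_of_proj_mem fun i x hx =>
        IsHigher.map (fun x => R.H_proj i x) hx
      T_mem := fun k hk x hx => IsHigher.map (R.H_T k hk) hx
      ξ_mem := fun x hx => IsHigher.map R.H_ξ hx
      L_mem := fun n hn x hx => IsHigher.L hn hx
      G_mem := fun n hn x hx => IsHigher.G hn hx }
  rcases hR N hN with h | h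
  · intro j k x _ hx
    have : x ∈ N := IsHigher.step j x (by rw [hx, sub_self]; exact IsHigher.zero)
    rw [h] at this
    exact this
  · have : u ∈ N := h ▸ Submodule.mem_top
    exact absurd (IsHigher.eq_zero this hH) hu

/-! ### Vacuum vectors -/

variable (R) in
/-- A nonzero homogeneous common eigenvector of `L_0` and `H` annihilated by `∂/∂ξ`. -/
structure IsVacuum (i : ZMod 2) (ν b : ℂ) (v : M) : Prop where
  mem : v ∈ R.gr.part i
  ne_zero : v ≠ 0
  L_zero : R.L 0 v = ν • v
  H_v : R.H v = b • v
  d_v : R.d v = 0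

theorem L_zero_d (x : M) : R.L 0 (R.d x) = R.d (R.L 0 x) - (1 / 2 : ℂ) • R.d x := by
  simp (disch := omega) only [d_apply, map_sub, R.L_G 0, R.L_L 0 (-1), L_zero_ξ, map_add, map_smul]
  norm_num
  module

/-- A common eigenvector of `L_0` and `H` yields a vacuum vector: one of its homogeneous components,
or the image of this component under `∂/∂ξ`. -/
theorem exists_isVacuum {b μ : ℂ} {u : M} (hu : u ≠ 0) (hL : R.L 0 u = μ • u)
    (hH : R.H u = b • u) :
    ∃ i v ν, R.IsVacuum i ν b v ∧ (ν = μ ∨ ν = μ - 1 / 2) := by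
  obtain ⟨i, w, hw0, hwi, hwL, hwH⟩ : ∃ i, ∃ w, w ≠ 0 ∧ w ∈ R.gr.part i ∧ R.L 0 w = μ • w ∧
      R.H w = b • w := by
    by_cases h : R.gr.proj 0 u = 0
    · refine ⟨1, _, ?_, R.gr.proj_mem_part 1 u, ?_, ?_⟩
      · intro h1
        apply hu
        rw [← R.gr.sum_proj u, h, h1, add_zero]
      · rw [L_proj, hL, map_smul]
      · rw [H_proj, hH, map_smul]
    · exact ⟨0, _, h, R.gr.proj_mem_part 0 u, by rw [L_proj, hL, map_smul],
        by rw [H_proj, hH, map_smul]⟩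
  by_cases h : R.d w = 0
  · exact ⟨i, w, μ, ⟨hwi, hw0, hwL, hwH, h⟩, Or.inl rfl⟩
  · refine ⟨i + 1, R.d w, μ - 1 / 2, ⟨R.d_mem i w hwi, h, ?_, ?_, R.d_d w⟩, Or.inr rfl⟩
    · rw [L_zero_d, hwL, map_smul, sub_smul]
    · rw [H_d, hwH, map_smul]

/-- In an irreducible representation every finite dimensional weight space gives rise to a vacuum
vector. -/
theorem IsIrreducible.exists_isVacuum (hR : R.IsIrreducible) {μ : ℂ}
    (h0 : (R.L 0).eigenspace μ ≠ ⊥) (hfin : FiniteDimensional ℂ ((R.L 0).eigenspace μ)) :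
    ∃ i v ν b, R.IsVacuum i ν b v ∧ ∀ ν', R.NoHigher b ν' := by
  have hmap : ∀ x ∈ (R.L 0).eigenspace μ, R.H x ∈ (R.L 0).eigenspace μ := fun x hx => by
    rw [End.mem_eigenspace_iff] at hx ⊢
    rw [← H_L_zero, hx, map_smul]
  have : Nontrivial ((R.L 0).eigenspace μ) := Submodule.nontrivial_iff_ne_bot.2 h0
  obtain ⟨b, hb⟩ := End.exists_eigenvalue (R.H.restrict hmap)
  obtain ⟨u, hu⟩ := hb.exists_hasEigenvector
  have hu0 : (u : M) ≠ 0 := fun h => hu.2 (Subtype.ext h)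
  have huH : R.H u = b • (u : M) := congrArg Subtype.val hu.apply_eq_smul
  obtain ⟨i, v, ν, hv, -⟩ := ContactRep.exists_isVacuum hu0 (End.mem_eigenspace_iff.1 u.2) huH
  exact ⟨i, v, ν, b, hv, hR.noHigher hu0 huH⟩

theorem H_T_of_inv (hT : ∀ k x, R.T (-k) (R.T k x) = x) (k : ℤ) (x : M) :
    R.H (R.T k x) = R.T k (R.H x) := by
  rcases le_or_gt 0 k with hk | hk
  · exact R.H_T k hk x
  · have h := R.H_T (-k) (by omega) (R.T k x)
    rw [hT] at h
    have h2 := hT (-k) (R.H (R.T k x))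
    rw [neg_neg, ← h] at h2
    exact h2.symm

theorem L_zero_T_of_inv (hT : ∀ k x, R.T (-k) (R.T k x) = x) (k : ℤ) (x : M) :
    R.L 0 (R.T k x) = R.T k (R.L 0 x) + (k : ℂ) • R.T k x := by
  rcases le_or_gt 0 k with hk | hk
  · rw [R.L_T 0 k (by omega) hk, zero_add]
  · have h := R.L_T 0 (-k) (by omega) (by omega) (R.T k x)
    rw [hT, zero_add, hT] at h
    have h2 := hT (-k) (R.L 0 (R.T k x))
    rw [neg_neg] at h2
    rw [← h2, h, ← map_smul, ← map_add]
    push_cast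
    congr 1
    module

/-- If `t` is invertible, every finite dimensional weight space gives rise to a vacuum vector:
the eigenvalue of `H` is chosen with maximal real part. -/
theorem exists_isVacuum_of_invertible (hT : ∀ k x, R.T (-k) (R.T k x) = x) {μ : ℂ}
    (h0 : (R.L 0).eigenspace μ ≠ ⊥) (hfin : FiniteDimensional ℂ ((R.L 0).eigenspace μ)) :
    ∃ i v ν b, R.IsVacuum i ν b v ∧ R.NoHigher b ν ∧
      FiniteDimensional ℂ ((R.L 0).eigenspace ν) := by
  have hmap : ∀ x ∈ (R.L 0).eigenspace μ, R.H x ∈ (R.L 0).eigenspace μ := fun x hx => by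
    rw [End.mem_eigenspace_iff] at hx ⊢
    rw [← H_L_zero, hx, map_smul]
  have : Nontrivial ((R.L 0).eigenspace μ) := Submodule.nontrivial_iff_ne_bot.2 h0
  obtain ⟨b, hb, hmax⟩ := Set.exists_max_image {b | End.HasEigenvalue (R.H.restrict hmap) b} Complex.re
    (End.finite_hasEigenvalue _) (End.exists_eigenvalue (R.H.restrict hmap))
  obtain ⟨u, hu⟩ := hb.exists_hasEigenvector
  have hu0 : (u : M) ≠ 0 := fun h => hu.2 (Subtype.ext h)
  have huH : R.H u = b • (u : M) := congrArg Subtype.val hu.apply_eq_smul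
  obtain ⟨i, v, ν, hv, hν⟩ := ContactRep.exists_isVacuum hu0 (End.mem_eigenspace_iff.1 u.2) huH
  -- By the choice of `b`, no larger eigenvalue occurs in the weight `μ`.
  have hno : ∀ (j : ℕ) (x : M), R.L 0 x = μ • x → R.H x = (b + ((j : ℂ) + 1) / 2) • x →
      x = 0 := by
    intro j x hx hH
    by_contra hx0
    have he : End.HasEigenvalue (R.H.restrict hmap) (b + ((j : ℂ) + 1) / 2) := by
      refine End.hasEigenvalue_of_hasEigenvector
        (x := ⟨x, End.mem_eigenspace_iff.2 hx⟩) ⟨End.mem_eigenspace_iff.2 (Subtype.ext hH), ?_⟩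
      exact fun h => hx0 (congrArg Subtype.val h)
    have h1 := hmax _ he
    have h2 : (b + ((j : ℂ) + 1) / 2).re = b.re + ((j : ℝ) + 1) / 2 := by
      have : ((j : ℂ) + 1) / 2 = (((j : ℝ) + 1) / 2 : ℝ) := by push_cast; rfl
      rw [this, Complex.add_re, Complex.ofReal_re]
    rw [h2] at h1
    have : (0 : ℝ) ≤ j := Nat.cast_nonneg j
    linarith
  have hnoμ : R.NoHigher b μ := by
    intro j k x hx hH
    have h := hno j (R.T (-k) x) (by
      rw [L_zero_T_of_inv hT, hx, map_smul]; push_cast; module)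
      (by rw [H_T_of_inv hT, hH, map_smul])
    have h2 := hT (-k) x
    rw [h, map_zero] at h2
    exact h2.symm
  rcases hν with rfl | rfl
  · exact ⟨i, v, ν, b, hv, hnoμ, hfin⟩
  -- In the weights shifted by `1/2`, the claims follow from `x = ∂_ξ ξ x + ξ ∂_ξ x`.
  have hξ : ∀ (k : ℤ) (x : M), R.L 0 x = (μ - 1 / 2 + k) • x →
      R.L 0 (R.ξ x) = (μ + k) • R.ξ x := fun k x hx => by
    rw [L_zero_ξ, hx, map_smul]; module
  have hd : ∀ (k : ℤ) (x : M), R.L 0 x = (μ - 1 / 2 + k) • x →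
      R.L 0 (R.d x) = (μ + (k - 1 : ℤ)) • R.d x := fun k x hx => by
    rw [L_zero_d, hx, map_smul]; push_cast; module
  refine ⟨i, v, _, b, hv, ?_, ?_⟩
  · intro j k x hx hH
    rw [← R.d_ξ x, hnoμ j k _ (hξ k x hx) (by rw [H_ξ, hH, map_smul]),
      hnoμ j (k - 1) _ (hd k x hx) (by rw [H_d, hH, map_smul])]
    simp
  · have hm1 : ∀ x ∈ (R.L 0).eigenspace (μ - 1 / 2), R.ξ x ∈ (R.L 0).eigenspace μ := by
      intro x hx
      rw [End.mem_eigenspace_iff] at hx ⊢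
      simpa using hξ 0 x (by simpa using hx)
    have hm2 : ∀ x ∈ (R.L 0).eigenspace (μ - 1 / 2),
        (R.T 1 ∘ₗ R.d) x ∈ (R.L 0).eigenspace μ := by
      intro x hx
      rw [End.mem_eigenspace_iff] at hx ⊢
      rw [LinearMap.comp_apply, L_zero_T_of_inv hT, hd 0 x (by simpa using hx), map_smul]
      push_cast
      module
    refine FiniteDimensional.of_injective ((R.ξ.restrict hm1).prod ((R.T 1 ∘ₗ R.d).restrict hm2)) ?_
    rw [injective_iff_map_eq_zero]
    intro x hx
    have h1 : R.ξ x = 0 := congrArg (fun y => (y.1 : M)) hx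
    have h2 : R.T 1 (R.d x) = 0 := congrArg (fun y => (y.2 : M)) hx
    have h3 := hT 1 (R.d x)
    rw [h2, map_zero] at h3
    refine Subtype.ext ?_
    rw [← R.d_ξ x, h1, ← h3]
    simp

end ContactRep

/-! ### Chains generated by vacuum vectors -/

namespace ContactRep

variable {M : Type u} [AddCommGroup M] [Module ℂ M]

variable {R : ContactRep (-1 ≤ ·) (0 ≤ ·) M}

theorem d_T (k : ℤ) (hk : 0 ≤ k) (x : M) : R.d (R.T k x) = R.T k (R.d x) := by
  simp (disch := omega) only [d_apply, R.L_T, R.G_T, R.ξ_T, map_add, map_sub, map_smul]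
  rcases hk.eq_or_lt with rfl | hk
  · simp
  · rw [R.ξ_T _ (by omega)]
    abel

theorem d_L_neg_one (x : M) : R.d (R.L (-1) x) = R.L (-1) (R.d x) := by
  simp only [d_apply, map_sub, L_neg_one_ξ, L_neg_one_G]

namespace IsVacuum

variable {i : ZMod 2} {ν b : ℂ} {v : M} (hv : R.IsVacuum i ν b v)
include hv

theorem T_one_L_neg_one : R.T 1 (R.L (-1) v) = (ν - b) • v := by
  have h := R.H_apply v
  have hd := hv.d_v
  rw [d_apply, sub_eq_zero] at hd
  rw [hv.H_v, hv.L_zero, ← hd, R.ξ_ξ, smul_zero] at h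
  linear_combination (norm := module) h

theorem L_neg_one_T (k : ℤ) (hk : 1 ≤ k) :
    R.L (-1) (R.T k v) = (ν - b + k) • R.T (k - 1) v := by
  rw [R.L_T _ _ (by omega) (by omega), show -1 + k = k - 1 by ring,
    show R.T k (R.L (-1) v) = R.T (k - 1) (R.T 1 (R.L (-1) v)) by
      rw [R.T_T _ _ (by omega) (by omega), sub_add_cancel],
    hv.T_one_L_neg_one, map_smul]
  module

theorem T {k : ℤ} (hk : 0 ≤ k) (h0 : R.T k v ≠ 0) : R.IsVacuum i (ν + k) b (R.T k v) where
  mem := R.T_mem _ _ _ hv.mem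
  ne_zero := h0
  L_zero := by
    rw [R.L_T 0 k (by omega) hk, zero_add, hv.L_zero, map_smul]
    module
  H_v := by rw [R.H_T k hk, hv.H_v, map_smul]
  d_v := by rw [d_T k hk, hv.d_v, map_zero]

theorem L_neg_one (h0 : R.L (-1) v ≠ 0) : R.IsVacuum i (ν - 1) b (R.L (-1) v) where
  mem := R.L_mem _ _ _ hv.mem
  ne_zero := h0
  L_zero := by
    rw [R.L_L 0 (-1) (by omega) (by omega), hv.L_zero, map_smul]
    push_cast
    norm_num
    module
  H_v := by rw [R.H_L_neg_one, hv.H_v, map_smul]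
  d_v := by rw [d_L_neg_one, hv.d_v, map_zero]

theorem smul {c : ℂ} (hc : c ≠ 0) : R.IsVacuum i ν b (c • v) where
  mem := Submodule.smul_mem _ _ hv.mem
  ne_zero := smul_ne_zero hc hv.ne_zero
  L_zero := by rw [map_smul, hv.L_zero, smul_comm]
  H_v := by rw [map_smul, hv.H_v, smul_comm]
  d_v := by rw [map_smul, hv.d_v, smul_zero]

/-- The chain of the vectors `t^k v` in case `t` is invertible. -/
theorem isChain_of_invertible (hTT : ∀ j k x, R.T j (R.T k x) = R.T (j + k) x) :
    R.IsChain (fun _ => True) (ν - b) b (fun k => R.T k v) := by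
  have hT : ∀ k x, R.T (-k) (R.T k x) = x := fun k x => by
    rw [hTT, neg_add_cancel, R.T_zero]
  have hd : ∀ k, R.d (R.T k v) = 0 := by
    intro k
    rcases le_or_gt 0 k with hk | hk
    · rw [d_T k hk, hv.d_v, map_zero]
    · have h := R.d_T (-k) (by omega) (R.T k v)
      rw [hT, hv.d_v] at h
      have h2 := hT (-k) (R.d (R.T k v))
      rw [← h, map_zero] at h2
      exact h2.symm
  have hL0 : ∀ k : ℤ, R.L 0 (R.T k v) = (ν + k) • R.T k v := fun k => by
    rw [L_zero_T_of_inv hT, hv.L_zero, map_smul]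
    module
  refine ⟨fun _ _ => trivial, fun _ _ => Or.inr trivial, ?_, ?_, ?_, fun k _ => hd k⟩
  · intro k _
    rw [hTT, add_comm]
  · intro k _
    have hk : R.IsVacuum i (ν + k) b (R.T k v) :=
      ⟨R.T_mem _ _ _ hv.mem, fun h => hv.ne_zero (by rw [← hT k v, h, map_zero]), hL0 k,
        by rw [H_T_of_inv hT, hv.H_v, map_smul], hd k⟩
    rw [← hT 1 (R.L (-1) _), hk.T_one_L_neg_one, map_smul, hTT, show -1 + k = k - 1 by ring]
    congr 1
    ring
  · intro k _
    rw [hL0]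
    congr 1
    ring

/-- The chain of the vectors `t^k v`, `k ≥ 0`, in case `v` is annihilated by `∂/∂t`. -/
theorem isChain_of_L_neg_one (h : R.L (-1) v = 0) :
    R.IsChain (0 ≤ ·) 0 b (fun k => R.T k v) ∧ ∀ k, 0 ≤ k → R.T k v ≠ 0 := by
  have hν : ν = b := by
    have h1 := hv.T_one_L_neg_one
    rw [h, map_zero, eq_comm, smul_eq_zero, sub_eq_zero] at h1
    exact h1.resolve_right hv.ne_zero
  subst hν
  have hne : ∀ k, 0 ≤ k → R.T k v ≠ 0 := by
    intro k hk
    induction k, hk using Int.leInduction with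
    | base => rw [R.T_zero]; exact hv.ne_zero
    | succ k hk ih =>
      intro h0
      have h1 := hv.L_neg_one_T (k + 1) (by omega)
      rw [h0, map_zero, sub_self, zero_add, add_sub_cancel_right, eq_comm, smul_eq_zero,
        Int.cast_eq_zero] at h1
      exact h1.elim (by omega) ih
  refine ⟨⟨fun k hk => by omega, ?_, ?_, ?_, ?_, ?_⟩, hne⟩
  · intro k hk
    rcases hk.eq_or_lt with rfl | hk
    · simp
    · right; omega
  · intro k hk
    rw [R.T_T _ _ (by omega) hk, add_comm]
  · intro k hk
    rcases hk.eq_or_lt with rfl | hk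
    · simp [R.T_zero, h]
    · rw [hv.L_neg_one_T k hk, sub_self]
  · intro k hk
    rw [(hv.T hk (hne k hk)).L_zero, zero_add]
  · intro k hk
    exact (hv.T hk (hne k hk)).d_v

/-- A vacuum vector can be divided by `t` as long as the eigenvalue of `t ∂/∂t` does not vanish. -/
theorem exists_antiderivatives (hl : ∀ j : ℕ, ν - b - j ≠ 0) : ∃ y : ℕ → M, y 0 = v ∧
    (∀ j : ℕ, R.IsVacuum i (ν - j) b (y j)) ∧
    (∀ j : ℕ, R.L (-1) (y j) = (ν - b - j) • y (j + 1)) ∧ ∀ j, R.T 1 (y (j + 1)) = y j := by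
  let y : ℕ → M := Nat.rec v fun j x => (ν - b - j)⁻¹ • R.L (-1) x
  have hy : ∀ j, y (j + 1) = (ν - b - j)⁻¹ • R.L (-1) (y j) := fun j => rfl
  have hvac : ∀ j : ℕ, R.IsVacuum i (ν - j) b (y j) := by
    intro j
    induction j with
    | zero => simpa [y] using hv
    | succ j ih =>
      rw [hy]
      have h0 : R.L (-1) (y j) ≠ 0 := by
        intro h
        have h1 := ih.T_one_L_neg_one
        rw [h, map_zero, eq_comm, smul_eq_zero] at h1
        refine h1.elim (fun h2 => hl j ?_) ih.ne_zero
        rw [← h2]; ring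
      have h1 := (ih.L_neg_one h0).smul (inv_ne_zero (hl j))
      rwa [show ν - (j : ℂ) - 1 = ν - ((j + 1 : ℕ) : ℂ) by push_cast; ring] at h1
  refine ⟨y, rfl, hvac, fun j => ?_, fun j => ?_⟩
  · rw [hy, smul_inv_smul₀ (hl j)]
  · rw [hy, map_smul, (hvac j).T_one_L_neg_one, show ν - (j : ℂ) - b = ν - b - j by ring,
      inv_smul_smul₀ (hl j)]

/-- The chain with `v` in place `m`, extended upwards by the `t^k v` and downwards by division
by `t`. -/
theorem exists_isChain (hl : ∀ j : ℕ, ν - b - j ≠ 0) (m : ℤ) : ∃ e : ℤ → M,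
    R.IsChain (fun _ => True) (ν - b - m) b e ∧ (∀ k, e k ∈ R.gr.part i) ∧
      (∀ k, m ≤ k → e k = R.T (k - m) v) ∧ ∀ k, k < m → e k ≠ 0 := by
  obtain ⟨y, hy0, hy, hL, hT⟩ := hv.exists_antiderivatives hl
  let e : ℤ → M := fun k => if m ≤ k then R.T (k - m) v else y (m - k).toNat
  have h1 : ∀ k, m ≤ k → e k = R.T (k - m) v := fun k hk => if_pos hk
  have h2 : ∀ k, k < m → e k = y (m - k).toNat := fun k hk => if_neg (by omega)
  have hcast : ∀ k, k ≤ m → (((m - k).toNat : ℕ) : ℂ) = m - k := fun k hk => by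
    have : (((m - k).toNat : ℤ) : ℂ) = ((m - k : ℤ) : ℂ) := by congr 1; omega
    push_cast at this
    exact this
  -- In the place `m` both descriptions of `e` apply.
  have h2' : ∀ k, k ≤ m → e k = y (m - k).toNat := by
    intro k hk
    rcases hk.eq_or_lt with rfl | hk
    · rw [h1 k le_rfl, sub_self, R.T_zero]; exact hy0.symm
    · exact h2 k hk
  refine ⟨e, ⟨fun _ _ => trivial, fun _ _ => Or.inr trivial, ?_, ?_, ?_, ?_⟩, ?_, h1, ?_⟩
  · intro k _
    rcases le_or_gt m k with hk | hk
    · rw [h1 k hk, h1 _ (by omega), R.T_T _ _ (by omega) (by omega)]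
      congr 1; ring_nf
    · rw [h2 k hk, h2' _ (by omega), show (m - k).toNat = (m - (k + 1)).toNat + 1 by omega, hT]
  · intro k _
    rcases lt_or_ge m k with hk | hk
    · rw [h1 k hk.le, h1 _ (by omega), hv.L_neg_one_T _ (by omega),
        show k - m - 1 = k - 1 - m by ring]
      congr 1; push_cast; ring
    · rw [h2' k hk, h2 (k - 1) (by omega), hL, hcast k hk,
        show (m - (k - 1)).toNat = (m - k).toNat + 1 by omega]
      congr 1; ring
  · intro k _
    rcases le_or_gt m k with hk | hk
    · rw [h1 k hk, R.L_T 0 _ (by omega) (by omega), hv.L_zero, map_smul, zero_add]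
      push_cast
      module
    · rw [h2 k hk, (hy _).L_zero, hcast k hk.le]
      congr 1; ring
  · intro k _
    rcases le_or_gt m k with hk | hk
    · rw [h1 k hk, d_T _ (by omega), hv.d_v, map_zero]
    · rw [h2 k hk, (hy _).d_v]
  · intro k
    rcases le_or_gt m k with hk | hk
    · rw [h1 k hk]; exact R.T_mem _ _ _ hv.mem
    · rw [h2 k hk]; exact (hy _).mem
  · intro k hk
    rw [h2 k hk]; exact (hy _).ne_zero

theorem exists_extremal_of_nat {n : ℕ} (hn : ν - b = n) :
    ∃ ν' w, R.IsVacuum i ν' b w ∧ (R.L (-1) w = 0 ∨ R.T 1 w = 0) := by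
  induction n generalizing ν v with
  | zero =>
    by_cases h : R.L (-1) v = 0
    · exact ⟨ν, v, hv, Or.inl h⟩
    · refine ⟨_, _, hv.L_neg_one h, Or.inr ?_⟩
      rw [hv.T_one_L_neg_one, hn, Nat.cast_zero, zero_smul]
  | succ n ih =>
    by_cases h : R.L (-1) v = 0
    · exact ⟨ν, v, hv, Or.inl h⟩
    · refine ih (hv.L_neg_one h) ?_
      push_cast at hn
      linear_combination hn

/-- If the eigenvalue `ν - b` of `t ∂/∂t` is an integer, then repeated application of `∂/∂t` or of
`t` leads to a vacuum vector annihilated by one of these operators. -/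
theorem exists_extremal {n : ℤ} (hn : ν - b = n) :
    ∃ ν' w, R.IsVacuum i ν' b w ∧ (R.L (-1) w = 0 ∨ R.T 1 w = 0) := by
  rcases le_or_gt 0 n with h0 | h0
  · lift n to ℕ using h0
    exact hv.exists_extremal_of_nat (by exact_mod_cast hn)
  · obtain ⟨m, rfl⟩ : ∃ m : ℕ, n = -m := ⟨(-n).toNat, by omega⟩
    clear h0
    induction m generalizing ν v with
    | zero => exact hv.exists_extremal_of_nat (n := 0) (by simpa using hn)
    | succ m ih =>
      by_cases h : R.T 1 v = 0
      · exact ⟨ν, v, hv, Or.inr h⟩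
      · refine ih (hv.T zero_le_one h) ?_
        push_cast at hn ⊢
        linear_combination hn

/-- The three kinds of chains correspond to the modules `Γ(l, b)` with `l ∉ ℤ`, `Γ⁺(0, b)` and
`Γ⁻(0, b)`. -/
theorem exists_isChain_trichotomy :
    (∃ (l : ℂ) (e : ℤ → M), (∀ n : ℤ, l ≠ n) ∧ R.IsChain (fun _ => True) l b e ∧ (∀ k, e k ∈ R.gr.part i) ∧
      ∀ k, e k ≠ 0) ∨
    (∃ e, R.IsChain (0 ≤ ·) 0 b e ∧ (∀ k, e k ∈ R.gr.part i) ∧ ∀ k, 0 ≤ k → e k ≠ 0) ∨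
    (∃ e, R.IsChain (fun _ => True) 0 b e ∧ (∀ k, e k ∈ R.gr.part i) ∧ (∀ k, 0 ≤ k → e k = 0) ∧
      ∀ k, k < 0 → e k ≠ 0) := by
  by_cases hint : ∃ n : ℤ, ν - b = n
  · obtain ⟨n, hn⟩ := hint
    right
    obtain ⟨ν', w, hw, h | h⟩ := hv.exists_extremal hn
    · obtain ⟨h1, h2⟩ := hw.isChain_of_L_neg_one h
      exact Or.inl ⟨_, h1, fun k => R.T_mem _ _ _ hw.mem, h2⟩
    · right
      have hν : ν' - b = -1 := by
        have h1 := R.L_T (-1) 1 (by omega) (by omega) w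
        norm_num at h1
        rw [h, map_zero, hw.T_one_L_neg_one, R.T_zero] at h1
        have h2 : (ν' - b + 1) • w = 0 := by rw [add_smul, one_smul]; exact h1.symm
        exact eq_neg_of_add_eq_zero_left ((smul_eq_zero.1 h2).resolve_right hw.ne_zero)
      have hne : ∀ j : ℕ, ν' - b - j ≠ 0 := by
        intro j h0
        rw [hν] at h0
        have : ((-1 - j : ℤ) : ℂ) = 0 := by push_cast; exact h0
        have := Int.cast_eq_zero.1 this
        omega
      -- In `Γ⁻(0, b)` the vector annihilated by `t` is the class of `t^{-1}`.
      obtain ⟨e, he, hmem, h1, h2⟩ := hw.exists_isChain hne (-1)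
      rw [hν] at he
      norm_num at he
      refine ⟨e, he, hmem, fun k hk => ?_, fun k hk => ?_⟩
      · rw [h1 k (by omega), show k - -1 = k + 1 by ring, ← R.T_T k 1 hk (by omega), h, map_zero]
      · rcases (show k ≤ -1 by omega).eq_or_lt with rfl | hk'
        · rw [h1 _ le_rfl, sub_self, R.T_zero]; exact hw.ne_zero
        · exact h2 k hk'
  · left
    push Not at hint
    have hne : ∀ j : ℕ, ν - b - j ≠ 0 := fun j h0 => hint j (by
      rw [sub_eq_zero] at h0; exact_mod_cast h0)
    obtain ⟨e, he, hmem, h1, h2⟩ := hv.exists_isChain hne 0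
    rw [Int.cast_zero, sub_zero] at he
    refine ⟨ν - b, e, hint, he, hmem, fun k => ?_⟩
    rcases lt_or_ge k 0 with hk | hk
    · exact h2 k hk
    induction k, hk using Int.leInduction with
    | base => rw [h1 0 le_rfl, sub_self, R.T_zero]; exact hv.ne_zero
    | succ k hk ih =>
      intro h0
      have h3 := he.L_neg_one (k + 1) trivial
      rw [h0, map_zero, add_sub_cancel_right, eq_comm, smul_eq_zero] at h3
      refine h3.elim (fun h4 => hint (-(k + 1)) ?_) ih
      push_cast at h4 ⊢
      linear_combination h4

end IsVacuum

end ContactRep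

/-! ### Extension of the formulas from `𝔨⁺` to `𝔨` -/

namespace ContactRep

variable {M : Type u} [AddCommGroup M] [Module ℂ M]

/-- The restriction of a representation to the indices belonging to `𝔨⁺ ⋉ A⁺`. -/
abbrev toPlus (R : ContactRep (fun _ => True) (fun _ => True) M) :
    ContactRep (-1 ≤ ·) (0 ≤ ·) M :=
  R.mono (fun _ _ => trivial) (fun _ _ => trivial)

variable {R : ContactRep (fun _ => True) (fun _ => True) M}

variable (R) in
/-- The defect of the identity `L_n v = (l + b (n + 1)) t^n v`, shifted to the weight of `v`. -/
def defect (l b : ℂ) (v : M) (n : ℤ) : M := R.T (-n) (R.L n v) - (l + b * (n + 1)) • v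

theorem T_neg_T (k : ℤ) (x : M) : R.T (-k) (R.T k x) = x := by
  rw [R.T_T _ _ trivial trivial, neg_add_cancel, R.T_zero]

theorem L_of_defect {l b : ℂ} {v : M} {n : ℤ} (h : R.defect l b v n = 0) :
    R.L n v = (l + b * (n + 1)) • R.T n v := by
  rw [defect, sub_eq_zero] at h
  rw [← map_smul, ← h, R.T_T _ _ trivial trivial, add_neg_cancel, R.T_zero]

/-- If `L_m v` is as in `Γ(l, b)`, then `t^{-m} L_m` acts on the defects in a triangular way; the
terms involving `v` itself cancel. -/
theorem T_L_defect {l b : ℂ} {v : M} {m : ℤ} (hm : R.L m v = (l + b * (m + 1)) • R.T m v) (n : ℤ) :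
    R.T (-m) (R.L m (R.defect l b v n)) = (l + b * (m + 1) - n) • R.defect l b v n +
      ((n : ℂ) - m) • R.defect l b v (m + n) := by
  have h1 : R.L m (R.T (-n) (R.L n v)) = R.T (-n) (R.L m (R.L n v)) -
      (n : ℂ) • R.T (m - n) (R.L n v) := by
    rw [R.L_T _ _ trivial trivial]
    push_cast
    rw [sub_eq_add_neg m n]
    module
  have h2 : R.L m (R.L n v) = (l + b * (m + 1)) • (R.T m (R.L n v) + (m : ℂ) • R.T (n + m) v) +
      ((n : ℂ) - m) • R.L (m + n) v := by
    rw [R.L_L _ _ trivial trivial, hm, map_smul, R.L_T _ _ trivial trivial]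
  simp only [defect, map_sub, map_smul, hm, h1, h2, map_add, R.T_T _ _ trivial trivial]
  rw [show -m + (-n + m) = -n by ring, show -m + (-n + (n + m)) = 0 by ring,
    show -m + -n = -(m + n) by ring, show -m + (m - n) = -n by ring, neg_add_cancel, R.T_zero]
  push_cast
  module

theorem L_zero_defect {l b : ℂ} {v : M} {ν : ℂ} (hv : R.L 0 v = ν • v) (n : ℤ) :
    R.L 0 (R.defect l b v n) = ν • R.defect l b v n := by
  simp only [defect, map_sub, map_smul, R.L_T _ _ trivial trivial, R.L_L 0 n trivial trivial, hv,
    map_add, zero_add]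
  push_cast
  module

/-- The defects of `L_{-2}, …, L_{-N-1}` are eigenvectors of `t^{-N} L_N` for distinct eigenvalues,
so that in a finite dimensional weight space they cannot all be nonzero for large `N`; and from the
vanishing of one of them follows that of the first one. -/
theorem defect_neg_two {l b ν : ℂ} {v : M} (hv : R.L 0 v = ν • v)
    (hL : ∀ n : ℤ, -1 ≤ n → R.L n v = (l + b * (n + 1)) • R.T n v)
    (hfin : FiniteDimensional ℂ ((R.L 0).eigenspace ν)) : R.defect l b v (-2) = 0 := by
  have hz : ∀ n : ℤ, -1 ≤ n → R.defect l b v n = 0 := fun n hn => by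
    rw [defect, hL n hn, map_smul, T_neg_T, sub_self]
  obtain ⟨k, hk⟩ : ∃ k : ℕ, R.defect l b v (-(k + 2)) = 0 := by
    by_contra! hne
    let N := finrank ℂ ((R.L 0).eigenspace ν) + 1
    have hvec : ∀ i : Fin N, End.HasEigenvector (R.T (-N) ∘ₗ R.L N)
        (l + b * ((N : ℤ) + 1) + ((i : ℕ) + 2)) (R.defect l b v (-((i : ℕ) + 2))) := by
      intro i
      refine ⟨End.mem_eigenspace_iff.2 ?_, hne i⟩
      have h := T_L_defect (hL N (by omega)) (-((i : ℕ) + 2))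
      rw [hz (N + -((i : ℕ) + 2)) (by have := i.2; omega)] at h
      rw [LinearMap.comp_apply, h]
      push_cast
      module
    have hli : LinearIndependent ℂ fun i : Fin N => R.defect l b v (-((i : ℕ) + 2)) :=
      End.eigenvectors_linearIndependent' _ _ (fun i j hij => by
        simpa [Fin.ext_iff] using hij) _ hvec
    let z : Fin N → (R.L 0).eigenspace ν := fun i =>
      ⟨R.defect l b v (-((i : ℕ) + 2)), End.mem_eigenspace_iff.2 (L_zero_defect hv _)⟩
    have hli' : LinearIndependent ℂ z :=
      LinearIndependent.of_comp ((R.L 0).eigenspace ν).subtype hli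
    have := hli'.fintype_card_le_finrank
    simp [N] at this
  have h := T_L_defect (hL k (by omega)) (-(k + 2))
  rw [hk, map_zero, map_zero, smul_zero, zero_add, show (k : ℤ) + -(k + 2) = -2 by ring, eq_comm,
    smul_eq_zero] at h
  refine h.resolve_left fun h0 => ?_
  have : ((-(2 * k + 2) : ℤ) : ℂ) = 0 := by
    push_cast at h0 ⊢
    linear_combination h0
  have := Int.cast_eq_zero.1 this
  omega

/-- The formulas for the action of `𝔨⁺` extend to `𝔨` if the weight spaces are finite
dimensional. -/
theorem isGammaFamily_of_toPlus {l b : ℂ} {v : M}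
    (he : R.toPlus.IsChain (fun _ => True) l b (fun k => R.T k v))
    (hno : R.toPlus.NoHigher b (l + b))
    (hfin : FiniteDimensional ℂ ((R.L 0).eigenspace (l + b))) :
    R.IsGammaFamily (fun _ => True) l b (fun k => R.T k v) := by
  have hT : ∀ j k, R.T j (R.T k v) = R.T (j + k) v := fun j k => R.T_T j k trivial trivial v
  have hplus : ∀ n k, -1 ≤ n → R.L n (R.T k v) = (l + k + b * (n + 1)) • R.T (n + k) v :=
    fun n k hn => he.L_e hno n k hn trivial
  have hneg2 : ∀ k, R.L (-2) (R.T k v) = (l + k - b) • R.T (-2 + k) v := by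
    intro k
    have h0 : R.L 0 v = (l + b) • v := by
      have h := hplus 0 0 (by omega)
      simpa [R.T_zero] using h
    have hd : R.defect l b v (-2) = 0 := defect_neg_two h0 (fun n hn => by
      have h := hplus n 0 hn
      simpa [R.T_zero] using h) hfin
    rw [R.L_T _ _ trivial trivial, L_of_defect hd, map_smul, hT, add_comm k]
    push_cast
    module
  have hL : ∀ n k, R.L n (R.T k v) = (l + k + b * (n + 1)) • R.T (n + k) v := by
    intro n
    rcases le_or_gt (-1) n with hn | hn
    · exact fun k => hplus n k hn
    replace hn : n ≤ -2 := by omega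
    induction n, hn using Int.leInductionDown with
    | base =>
      intro k
      rw [hneg2]
      congr 1
      push_cast
      ring
    | pred n hn ih =>
      intro k
      have h := R.L_L (-1) n trivial trivial (R.T k v)
      rw [ih, hplus (-1) k le_rfl, map_smul, map_smul, ih, hplus (-1) _ le_rfl,
        show n + (-1 + k) = n - 1 + k by ring, show -1 + (n + k) = n - 1 + k by ring,
        show -1 + n = n - 1 by ring] at h
      have hc : ((n : ℂ) + 1) ≠ 0 := by
        have : ((n + 1 : ℤ) : ℂ) ≠ 0 := Int.cast_ne_zero.2 (by omega)
        exact_mod_cast this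
      refine smul_right_injective M hc ?_
      push_cast at h ⊢
      linear_combination (norm := module) -h
  have hLξ : ∀ n k, R.L n (R.ξ (R.T k v)) =
      (l + k + (n + 1) * (b + 1 / 2)) • R.ξ (R.T (n + k) v) := fun n k =>
    L_ξ_of_L (e := fun k => R.T k v) trivial (Or.inr ⟨trivial, hT n k⟩) (hL n k)
  have hG1 : ∀ k, R.G (-1) (R.T k v) = (l + k) • R.ξ (R.T (k - 1) v) := fun k =>
    he.G_neg_one k trivial
  have hG : ∀ n k, n ≠ -2 →
      R.G n (R.T k v) = (k + l + 2 * b * (n + 1)) • R.ξ (R.T (n + k) v) := fun n k hn =>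
    G_of_L (e := fun k => R.T k v) hn trivial trivial (hL _ k) (Or.inr (hLξ _ _)) (hG1 k) (hG1 _)
  refine ⟨fun j k _ _ => hT j k, fun n k _ _ => hL n k, fun n k _ _ => ?_⟩
  by_cases hn : n = -2
  · subst hn
    have h := R.L_G (-2) 0 trivial trivial (R.T k v)
    rw [hG 0 k (by omega), hL, map_smul, map_smul, hLξ, hG 0 _ (by omega),
      show -2 + (0 + k) = -2 + k by ring, zero_add (-2 + k), add_zero] at h
    refine smul_right_injective M (show (3 / 2 : ℂ) ≠ 0 by norm_num) ?_
    push_cast at h ⊢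
    linear_combination (norm := module) -h
  · exact hG n k hn

end ContactRep

/-! ### The operators on a jet module -/

namespace JetPair

/-- The pair `p` is spanned by the `L_n`, `G_n` with `I n` and by the `t^k`, `t^k ξ` with `J k`. The
closure properties express that the brackets stay in range, up to those which vanish. -/
structure IsSpanned (p : JetPair) (I J : ℤ → Prop) : Prop where
  lie_eq : p.lie.carrier = Submodule.span ℂ (L '' {n | I n} ∪ G '' {n | I n})
  alg_eq : Subalgebra.toSubmodule p.alg =
    Submodule.span ℂ (t '' {k | J k} ∪ (fun k => t k * ξ) '' {k | J k})
  zero : J 0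
  succ : ∀ n, I n → J (n + 1)
  self : ∀ n, I n → n = -1 ∨ J n
  add : ∀ n k, I n → J k → k = 0 ∨ J (n + k)

theorem isSpanned_pairKA : pairKA.IsSpanned (fun _ => True) (fun _ => True) where
  lie_eq := by
    refine (eq_top_iff.2 ?_).symm
    rw [← K.basis.span_eq, Submodule.span_le]
    rintro _ ⟨n | n, rfl⟩
    · exact Submodule.subset_span (Or.inl ⟨n, trivial, rfl⟩)
    · exact Submodule.subset_span (Or.inr ⟨n, trivial, rfl⟩)
  alg_eq := by
    change Subalgebra.toSubmodule (⊤ : Subalgebra ℂ A) = _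
    rw [Algebra.top_toSubmodule]
    refine (eq_top_iff.2 ?_).symm
    rw [← A.basis.span_eq, Submodule.span_le]
    rintro _ ⟨n | n, rfl⟩
    · exact Submodule.subset_span (Or.inl ⟨n, trivial, (A.basis_inl n).symm⟩)
    · exact Submodule.subset_span (Or.inr ⟨n, trivial, (A.basis_inr n).symm⟩)
  zero := trivial
  succ _ _ := trivial
  self _ _ := Or.inr trivial
  add _ _ _ _ := Or.inr trivial

theorem isSpanned_pairKplusA : pairKplusA.IsSpanned (-1 ≤ ·) (fun _ => True) where
  lie_eq := rfl
  alg_eq := isSpanned_pairKA.alg_eq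
  zero := trivial
  succ _ _ := trivial
  self _ _ := Or.inr trivial
  add _ _ _ _ := Or.inr trivial

theorem isSpanned_pairKplusAplus : pairKplusAplus.IsSpanned (-1 ≤ ·) (0 ≤ ·) where
  lie_eq := rfl
  alg_eq := rfl
  zero := le_rfl
  succ n hn := by omega
  self n hn := by omega
  add n k hn hk := by omega

variable {p : JetPair} {I J : ℤ → Prop}

theorem IsSpanned.L_mem (hp : p.IsSpanned I J) {n : ℤ} (hn : I n) :
    ((L n, 0) : KA) ∈ p.ext.carrier :=
  ⟨hp.lie_eq ▸ Submodule.subset_span (Or.inl ⟨n, hn, rfl⟩), zero_mem _⟩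

theorem IsSpanned.G_mem (hp : p.IsSpanned I J) {n : ℤ} (hn : I n) :
    ((G n, 0) : KA) ∈ p.ext.carrier :=
  ⟨hp.lie_eq ▸ Submodule.subset_span (Or.inr ⟨n, hn, rfl⟩), zero_mem _⟩

theorem IsSpanned.t_mem (hp : p.IsSpanned I J) {k : ℤ} (hk : J k) : t k ∈ p.alg := by
  rw [← Subalgebra.mem_toSubmodule, hp.alg_eq]
  exact Submodule.subset_span (Or.inl ⟨k, hk, rfl⟩)

theorem IsSpanned.ξ_mem (hp : p.IsSpanned I J) : ξ ∈ p.alg := by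
  rw [← Subalgebra.mem_toSubmodule, hp.alg_eq]
  exact Submodule.subset_span (Or.inr ⟨0, hp.zero, by simp [t_zero]⟩)

theorem inr_mem_ext {a : A} (ha : a ∈ p.alg) : ((0, a) : KA) ∈ p.ext.carrier :=
  ⟨zero_mem _, ha⟩

/-- The extended algebra is spanned by the elements coming from the spanning sets. -/
theorem IsSpanned.ext_induction (hp : p.IsSpanned I J) {Q : KA → Prop}
    (hL : ∀ n, I n → Q (L n, 0)) (hG : ∀ n, I n → Q (G n, 0)) (ht : ∀ k, J k → Q (0, t k))
    (hξ : ∀ k, J k → Q (0, t k * ξ))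
    (hadd : ∀ x ∈ p.ext.carrier, ∀ y ∈ p.ext.carrier, Q x → Q y → Q (x + y))
    (hsmul : ∀ (c : ℂ), ∀ x ∈ p.ext.carrier, Q x → Q (c • x)) {x : KA} (hx : x ∈ p.ext.carrier) :
    Q x := by
  have h0 : Q 0 := by
    have h := hsmul 0 _ (inr_mem_ext (hp.t_mem hp.zero)) (ht 0 hp.zero)
    rwa [zero_smul] at h
  have h1 : ∀ y, y ∈ Submodule.span ℂ (L '' {n | I n} ∪ G '' {n | I n}) → Q (y, 0) := by
    intro y hy
    refine Submodule.span_induction (p := fun y _ => Q (y, 0)) ?_ h0 ?_ ?_ hy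
    · rintro _ (⟨n, hn, rfl⟩ | ⟨n, hn, rfl⟩)
      exacts [hL n hn, hG n hn]
    · intro y z hy hz h h'
      rw [← hp.lie_eq] at hy hz
      simpa using hadd _ ⟨hy, zero_mem _⟩ _ ⟨hz, zero_mem _⟩ h h'
    · intro c y hy h
      rw [← hp.lie_eq] at hy
      simpa using hsmul c _ ⟨hy, zero_mem _⟩ h
  have h2 : ∀ a, a ∈ Submodule.span ℂ (t '' {k | J k} ∪ (fun k => t k * ξ) '' {k | J k}) →
      Q (0, a) := by
    intro y hy
    refine Submodule.span_induction (p := fun y _ => Q (0, y)) ?_ h0 ?_ ?_ hy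
    · rintro _ (⟨n, hn, rfl⟩ | ⟨n, hn, rfl⟩)
      exacts [ht n hn, hξ n hn]
    · intro y z hy hz h h'
      rw [← hp.alg_eq] at hy hz
      simpa using hadd _ ⟨zero_mem _, hy⟩ _ ⟨zero_mem _, hz⟩ h h'
    · intro c y hy h
      rw [← hp.alg_eq] at hy
      simpa using hsmul c _ ⟨zero_mem _, hy⟩ h
  obtain ⟨y, a⟩ := x
  have h := hadd (y, 0) ⟨hx.1, zero_mem _⟩ (0, a) ⟨zero_mem _, hx.2⟩ (h1 y (hp.lie_eq ▸ hx.1))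
    (h2 a (hp.alg_eq ▸ hx.2))
  simpa using h

variable {M : Type u} [AddCommGroup M] [Module ℂ M] (X : SuperModule p.ext.carrier M)

open Classical in
/-- The action of an element of `𝔨 ⋉ A` on a module over `𝔤 ⋉ 𝒜`, set to `0` for the elements
outside `𝔤 ⋉ 𝒜`. -/
def op (y : KA) : End ℂ M := if h : y ∈ p.ext.carrier then X.act ⟨y, h⟩ else 0

variable {X}

theorem op_of_mem {y : KA} (h : y ∈ p.ext.carrier) : op X y = X.act ⟨y, h⟩ := dif_pos h

theorem op_add {y z : KA} (hy : y ∈ p.ext.carrier) (hz : z ∈ p.ext.carrier) :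
    op X (y + z) = op X y + op X z := by
  rw [op_of_mem hy, op_of_mem hz, op_of_mem (add_mem hy hz), ← map_add]
  rfl

theorem op_smul (c : ℂ) (y : KA) : op X (c • y) = c • op X y := by
  rcases eq_or_ne c 0 with rfl | hc
  · rw [zero_smul, zero_smul, op_of_mem (zero_mem _)]
    exact map_zero X.act
  · by_cases hy : y ∈ p.ext.carrier
    · rw [op_of_mem hy, op_of_mem (Submodule.smul_mem _ c hy), ← map_smul]
      rfl
    · rw [op, op, dif_neg hy, dif_neg (fun h => hy ((Submodule.smul_mem_iff _ hc).1 h)), smul_zero]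

theorem op_mem {i j : ZMod 2} {y : KA} {m : M}
    (hy : y ∈ (LieSuperalgebra.gr (𝔤 := KA)).part i) (hm : m ∈ X.gr.part j) :
    op X y m ∈ X.gr.part (j + i) := by
  by_cases h : y ∈ p.ext.carrier
  · rw [op_of_mem h, add_comm]
    exact X.act_mem (x := ⟨y, h⟩) hy hm
  · rw [op, dif_neg h]
    exact zero_mem _

theorem op_brk {i j : ZMod 2} {y z : KA} (hy : y ∈ p.ext.carrier) (hz : z ∈ p.ext.carrier)
    (hyi : y ∈ (LieSuperalgebra.gr (𝔤 := KA)).part i)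
    (hzj : z ∈ (LieSuperalgebra.gr (𝔤 := KA)).part j) (m : M) :
    op X ((LieSuperalgebra.brk : KA →ₗ[ℂ] KA →ₗ[ℂ] KA) y z) m =
      op X y (op X z m) - koszul i j • op X z (op X y m) := by
  rw [op_of_mem hy, op_of_mem hz, op_of_mem (p.ext.brk_mem hy hz)]
  exact X.act_brk (x := ⟨y, hy⟩) (y := ⟨z, hz⟩) hyi hzj m

theorem op_mul (hX : p.IsAssociative X) {a b : A} (ha : a ∈ p.alg) (hb : b ∈ p.alg) (m : M) :
    op X (0, a * b) m = op X (0, a) (op X (0, b) m) := by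
  rw [op_of_mem (inr_mem_ext ha), op_of_mem (inr_mem_ext hb),
    op_of_mem (inr_mem_ext (mul_mem ha hb))]
  exact hX.2 ⟨a, ha⟩ ⟨b, hb⟩ m

theorem brk_inl_inl (x y : K) :
    (LieSuperalgebra.brk : KA →ₗ[ℂ] KA →ₗ[ℂ] KA) (x, 0) (y, 0) = (K.brk x y, 0) := by
  change (K.brk x y, circ x 0 - twist circModule 0 y) = _
  simp

theorem brk_inl_inr (x : K) (a : A) :
    (LieSuperalgebra.brk : KA →ₗ[ℂ] KA →ₗ[ℂ] KA) (x, 0) (0, a) = (0, circ x a) := by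
  change (K.brk x 0, circ x a - twist circModule 0 0) = _
  simp

theorem inl_L_even (n : ℤ) : ((L n, 0) : KA) ∈ (LieSuperalgebra.gr (𝔤 := KA)).part 0 :=
  ⟨NeveuSchwarz.L_mem n, zero_mem _⟩

theorem inl_G_odd (n : ℤ) : ((G n, 0) : KA) ∈ (LieSuperalgebra.gr (𝔤 := KA)).part 1 :=
  ⟨NeveuSchwarz.G_mem n, zero_mem _⟩

theorem inr_t_even (k : ℤ) : ((0, t k) : KA) ∈ (LieSuperalgebra.gr (𝔤 := KA)).part 0 :=
  ⟨zero_mem _, NeveuSchwarz.t_mem k⟩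

theorem inr_ξ_odd : ((0, ξ) : KA) ∈ (LieSuperalgebra.gr (𝔤 := KA)).part 1 :=
  ⟨zero_mem _, by
    have h := tξ_mem 0
    rwa [t_zero, one_mul] at h⟩

theorem IsSpanned.op_tξ (hp : p.IsSpanned I J) (hX : p.IsAssociative X) {k : ℤ} (hk : J k) (m : M) :
    op X (0, t k * ξ) m = op X (0, t k) (op X (0, ξ) m) :=
  op_mul hX (hp.t_mem hk) hp.ξ_mem m

/-- The operators by which a jet module is acted on. -/
def IsSpanned.contactRep (hp : p.IsSpanned I J) (hX : p.IsAssociative X) : ContactRep I J M where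
  gr := X.gr
  T k := op X (0, t k)
  ξ := op X (0, ξ)
  L n := op X (L n, 0)
  G n := op X (G n, 0)
  T_mem k i x hx := by simpa using op_mem (inr_t_even k) hx
  ξ_mem i x hx := op_mem inr_ξ_odd hx
  L_mem n i x hx := by simpa using op_mem (inl_L_even n) hx
  G_mem n i x hx := op_mem (inl_G_odd n) hx
  T_zero x := by
    rw [op_of_mem (inr_mem_ext (hp.t_mem hp.zero))]
    exact hX.1 x
  T_T j k hj hk x := by rw [← op_mul hX (hp.t_mem hj) (hp.t_mem hk), t_mul_t]
  ξ_T k hk x := by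
    rw [← op_mul hX hp.ξ_mem (hp.t_mem hk), ← op_mul hX (hp.t_mem hk) hp.ξ_mem, mul_comm]
  ξ_ξ x := by
    rw [← op_mul hX hp.ξ_mem hp.ξ_mem, ξ_mul_ξ, op_of_mem (y := (0, 0)) (zero_mem p.ext.carrier)]
    exact congrArg (· x) (map_zero X.act)
  L_L m n hm hn x := by
    have h := op_brk (X := X) (hp.L_mem hm) (hp.L_mem hn) (inl_L_even m) (inl_L_even n) x
    rw [brk_inl_inl, K.brk_LL, show (((n : ℂ) - m) • L (m + n), (0 : A)) =
      ((n : ℂ) - m) • ((L (m + n), 0) : KA) by simp, op_smul] at h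
    simp only [koszul, LinearMap.smul_apply] at h
    rw [h]
    simp
  L_G m n hm hn x := by
    have h := op_brk (X := X) (hp.L_mem hm) (hp.G_mem hn) (inl_L_even m) (inl_G_odd n) x
    rw [brk_inl_inl, K.brk_LG, show (((n : ℂ) + 1 / 2 - m / 2) • G (m + n), (0 : A)) =
      ((n : ℂ) + 1 / 2 - m / 2) • ((G (m + n), 0) : KA) by simp, op_smul] at h
    simp only [koszul, LinearMap.smul_apply] at h
    rw [h]
    simp
  G_G m n hm hn x := by
    have h := op_brk (X := X) (hp.G_mem hm) (hp.G_mem hn) (inl_G_odd m) (inl_G_odd n) x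
    rw [brk_inl_inl, K.brk_GG, show ((-2 : ℂ) • L (m + n + 1), (0 : A)) =
      (-2 : ℂ) • ((L (m + n + 1), 0) : KA) by simp, op_smul] at h
    simp only [koszul, LinearMap.smul_apply] at h
    simp only [and_self, if_true] at h
    linear_combination (norm := module) -h
  L_T n k hn hk x := by
    have h := op_brk (X := X) (hp.L_mem hn) (inr_mem_ext (hp.t_mem hk)) (inl_L_even n) (inr_t_even k) x
    rw [brk_inl_inr, circ_eq, gammaK_L_t, show ((0 : K), ((0 : ℂ) + k + 0 * (n + 1)) • t (n + k)) =
      (k : ℂ) • ((0, t (n + k)) : KA) by simp, op_smul] at h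
    simp only [koszul, LinearMap.smul_apply] at h
    rw [h]
    simp
  L_ξ n hn x := by
    have h := op_brk (X := X) (hp.L_mem hn) (inr_mem_ext hp.ξ_mem) (inl_L_even n) inr_ξ_odd x
    have hξ : circ (L n) ξ = (((n : ℂ) + 1) / 2) • (t n * ξ) := by
      have h := gammaK_L_tξ 0 0 n 0
      rw [t_zero, one_mul, ← circ_eq, add_zero] at h
      rw [h]
      congr 1
      push_cast
      ring
    rw [brk_inl_inr, hξ, show ((0 : K), (((n : ℂ) + 1) / 2) • (t n * ξ)) =
      (((n : ℂ) + 1) / 2) • ((0, t n * ξ) : KA) by simp, op_smul] at h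
    simp only [koszul, LinearMap.smul_apply] at h
    rcases hp.self n hn with rfl | hJ
    · norm_num at h ⊢
      exact (sub_eq_zero.1 h.symm)
    · rw [hp.op_tξ hX hJ] at h
      rw [h]
      simp
  G_T n k hn hk x := by
    have h := op_brk (X := X) (hp.G_mem hn) (inr_mem_ext (hp.t_mem hk)) (inl_G_odd n) (inr_t_even k) x
    rw [brk_inl_inr, circ_eq, gammaK_G_t,
      show ((0 : K), ((k : ℂ) + 0 + 2 * 0 * (n + 1)) • (t (n + k) * ξ)) =
        (k : ℂ) • ((0, t (n + k) * ξ) : KA) by simp, op_smul] at h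
    simp only [koszul, LinearMap.smul_apply] at h
    rcases hp.add n k hn hk with rfl | hJ
    · simp at h ⊢
      exact (sub_eq_zero.1 h.symm)
    · rw [hp.op_tξ hX hJ] at h
      rw [h]
      simp
  G_ξ n hn x := by
    have h := op_brk (X := X) (hp.G_mem hn) (inr_mem_ext hp.ξ_mem) (inl_G_odd n) inr_ξ_odd x
    have hξ : circ (G n) ξ = -t (n + 1) := by
      have h := gammaK_G_tξ 0 0 n 0
      rwa [t_zero, one_mul, ← circ_eq, add_zero] at h
    rw [brk_inl_inr, hξ, show ((0 : K), -t (n + 1)) = (-1 : ℂ) • ((0, t (n + 1)) : KA) by simp,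
      op_smul] at h
    simp only [koszul, LinearMap.smul_apply] at h
    simp only [and_self, if_true] at h
    linear_combination (norm := module) -h

theorem IsSpanned.isIrreducible (hp : p.IsSpanned I J) (hX : p.IsAssociative X)
    (hs : X.IsSimple) : (hp.contactRep hX).IsIrreducible := by
  intro N hN
  refine hs.2 N ⟨hN.isGraded, ?_⟩
  intro x m hm
  have h : op X x.1 m ∈ N := by
    refine hp.ext_induction (Q := fun x => op X x m ∈ N) (fun n hn => hN.L_mem n hn m hm)
      (fun n hn => hN.G_mem n hn m hm) (fun k hk => hN.T_mem k hk m hm) (fun k hk => ?_)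
      (fun x hx y hy h h' => ?_) (fun c x hx h => ?_) x.2
    · rw [hp.op_tξ hX hk]
      exact hN.T_mem k hk _ (hN.ξ_mem m hm)
    · rw [op_add hx hy]
      exact add_mem h h'
    · rw [op_smul]
      exact Submodule.smul_mem _ c h
  rwa [op_of_mem x.2] at h

end JetPair

/-! ### Homomorphisms into simple modules -/

namespace SuperModule

variable {𝔤 : Type u} [AddCommGroup 𝔤] [Module ℂ 𝔤] [LieSuperalgebra 𝔤]
  {M : Type v} [AddCommGroup M] [Module ℂ M] {N : Type w} [AddCommGroup N] [Module ℂ N]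

/-- A nonzero injective homomorphism of parity `i` into a simple module is an isomorphism up to a
parity change. -/
theorem IsSimple.isoUpToParity {X : SuperModule 𝔤 M} (hX : X.IsSimple) {Y : SuperModule 𝔤 N}
    (g : N →ₗ[ℂ] M) (i : ZMod 2) (hg : ∀ j a, a ∈ Y.gr.part j → g a ∈ X.gr.part (j + i))
    (hom : ∀ x a, g (Y.act x a) = X.act x (g a)) (hinj : ∀ a, g a = 0 → a = 0)
    (hne : ∃ a, g a ≠ 0) : X.IsoUpToParity Y := by
  have hproj : ∀ j a, X.gr.proj j (g a) = g (Y.gr.proj (j + i) a) := fun j a => by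
    rw [Y.gr.map_proj X.gr i g hg, add_assoc]
    rcases zmod_two_cases i with rfl | rfl
    · simp
    · rw [show (1 + 1 : ZMod 2) = 0 from rfl, add_zero]
  have hsub : X.IsSubmodule (LinearMap.range g) := by
    refine ⟨X.gr.isGraded_of_proj_mem ?_, ?_⟩
    · rintro j _ ⟨a, rfl⟩
      exact ⟨_, (hproj j a).symm⟩
    · rintro x _ ⟨a, rfl⟩
      exact ⟨_, hom x a⟩
  have htop : LinearMap.range g = ⊤ := by
    refine (hX.2 _ hsub).resolve_left fun h => ?_
    obtain ⟨a, ha⟩ := hne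
    exact ha (LinearMap.congr_fun (LinearMap.range_eq_bot.1 h) a)
  have hker : LinearMap.ker g = ⊥ := (Submodule.eq_bot_iff _).2 fun a ha => hinj a ha
  let e : N ≃ₗ[ℂ] M := LinearEquiv.ofBijective g
    ⟨LinearMap.ker_eq_bot.1 hker, LinearMap.range_eq_top.1 htop⟩
  have he : ∀ m, g (e.symm m) = m := fun m => e.apply_symm_apply m
  have hpar : ∀ j, ∀ m ∈ X.gr.part j, e.symm m ∈ Y.gr.part (j + i) := by
    intro j m hm
    have h := hproj j (e.symm m)
    rw [he, X.gr.proj_of_mem hm, if_pos rfl] at h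
    have h2 : e.symm m = Y.gr.proj (j + i) (e.symm m) := by
      conv_lhs => rw [h]
      exact e.symm_apply_apply _
    rw [h2]
    exact Y.gr.proj_mem_part _ _
  have hact : ∀ x m, e.symm (X.act x m) = Y.act x (e.symm m) := by
    intro x m
    rw [LinearEquiv.symm_apply_eq]
    change _ = g _
    rw [hom, he]
  rcases zmod_two_cases i with rfl | rfl
  · exact Or.inl ⟨e.symm, by simpa using hpar, hact⟩
  · exact Or.inr ⟨e.symm, hpar, hact⟩

end SuperModule

/-! ### Homomorphisms from the modules `Γ(λ, b)` -/

section GammaMap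

variable {M : Type u} [AddCommGroup M] [Module ℂ M]

/-- The vectors `e k` and `ξ (e k)`, which correspond to `t^k` and `t^k ξ`. -/
def gammaVec (Ξ : End ℂ M) (e : ℤ → M) : ℤ ⊕ ℤ → M := Sum.elim e fun k => Ξ (e k)

/-- The linear map taking `t^k` to `e k` and `t^k ξ` to `ξ (e k)`. -/
def gammaMap (Ξ : End ℂ M) (e : ℤ → M) : A →ₗ[ℂ] M := A.basis.constr ℂ (gammaVec Ξ e)

theorem gammaMap_t (Ξ : End ℂ M) (e : ℤ → M) (k : ℤ) : gammaMap Ξ e (t k) = e k := by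
  rw [gammaMap, ← A.basis_inl, Basis.constr_basis]
  rfl

theorem gammaMap_tξ (Ξ : End ℂ M) (e : ℤ → M) (k : ℤ) : gammaMap Ξ e (t k * ξ) = Ξ (e k) := by
  rw [gammaMap, ← A.basis_inr, Basis.constr_basis]
  rfl

/-- The span of the `t^k` and `t^k ξ` with `S k`. -/
def AOn (S : ℤ → Prop) : Submodule ℂ A :=
  Submodule.span ℂ (t '' {k | S k} ∪ (fun k => t k * ξ) '' {k | S k})

theorem AOn_eq (S : ℤ → Prop) : AOn S = Submodule.span ℂ (A.basis '' {i | S (i.elim id id)}) := by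
  rw [AOn]
  congr 1
  ext x
  constructor
  · rintro (⟨k, hk, rfl⟩ | ⟨k, hk, rfl⟩)
    exacts [⟨Sum.inl k, hk, A.basis_inl k⟩, ⟨Sum.inr k, hk, A.basis_inr k⟩]
  · rintro ⟨k | k, hk, rfl⟩
    exacts [Or.inl ⟨k, hk, (A.basis_inl k).symm⟩, Or.inr ⟨k, hk, (A.basis_inr k).symm⟩]

theorem mem_AOn {S : ℤ → Prop} {a : A} :
    a ∈ AOn S ↔ ∀ i, A.basis.repr a i ≠ 0 → S (i.elim id id) := by
  rw [AOn_eq, A.basis.mem_span_image]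
  exact ⟨fun h i hi => h (by simpa using hi), fun h i hi => h i (by simpa using hi)⟩

theorem gammaMap_mem {S : Superspace M} {Ξ : End ℂ M}
    (hΞ : ∀ i x, x ∈ S.part i → Ξ x ∈ S.part (i + 1)) {e : ℤ → M} {i : ZMod 2}
    (he : ∀ k, e k ∈ S.part i) (j : ZMod 2) (a : A) (ha : a ∈ A.gr.part j) :
    gammaMap Ξ e a ∈ S.part (j + i) := by
  refine Superspace.ofBasis_induction A.basis (P := fun a => gammaMap Ξ e a ∈ S.part (j + i))
    (fun k => ?_) (fun x y h h' => ?_) (fun c x h => ?_) ha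
  · rcases zmod_two_cases j with rfl | rfl
    · rw [Superspace.idx_zero, A.basis_inl, gammaMap_t, zero_add]
      exact he k
    · rw [Superspace.idx_one, A.basis_inr, gammaMap_tξ, add_comm]
      exact hΞ i _ (he k)
  · rw [map_add]; exact add_mem h h'
  · rw [map_smul]; exact Submodule.smul_mem _ c h

/-- The kernel of `gammaMap` is controlled by the vanishing of the `e k`, since the `e k` and
`ξ (e k)` have distinct weights and `ξ (e k)` vanishes only if `e k` does. -/
theorem ContactRep.IsChain.repr_eq_zero {R : ContactRep (-1 ≤ ·) (0 ≤ ·) M} {S : ℤ → Prop}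
    {l b : ℂ} {e : ℤ → M} (he : R.IsChain S l b e) {a : A} (haS : a ∈ AOn S)
    (ha : gammaMap R.ξ e a = 0) (i : ℤ ⊕ ℤ) (hi : S (i.elim id id)) (hi0 : e (i.elim id id) ≠ 0) :
    A.basis.repr a i = 0 := by
  let w := gammaVec R.ξ e
  let μ : ℤ ⊕ ℤ → ℂ := Sum.elim (fun k => l + b + k) fun k => l + b + k + 1 / 2
  let s : Set (ℤ ⊕ ℤ) := {i | (R.L 0).HasEigenvector (μ i) (w i)}
  have hμ : Function.Injective μ := by
    have hne : ∀ j k : ℤ, (l + b + (j : ℂ)) ≠ l + b + k + 1 / 2 := by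
      intro j k h
      have h1 : ((2 * j : ℤ) : ℂ) = ((2 * k + 1 : ℤ) : ℂ) := by
        push_cast
        linear_combination 2 * h
      have := Int.cast_injective h1
      omega
    rintro (j | j) (k | k) h
    · simpa [μ] using h
    · exact absurd h (hne j k)
    · exact absurd h.symm (hne k j)
    · simpa [μ] using h
  have hs : ∀ j, S (j.elim id id) → e (j.elim id id) ≠ 0 → j ∈ s := by
    rintro (k | k) hk hk0
    · exact ⟨End.mem_eigenspace_iff.2 (he.L_zero k hk), hk0⟩
    · refine ⟨End.mem_eigenspace_iff.2 ?_, fun h => hk0 ?_⟩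
      · change R.L 0 (R.ξ (e k)) = (l + b + k + 1 / 2) • R.ξ (e k)
        rw [R.L_zero_ξ, he.L_zero k hk, map_smul]
        module
      · have h2 := R.d_ξ (e k)
        rw [he.d_e k hk, show R.ξ (e k) = 0 from h, map_zero, map_zero, add_zero] at h2
        exact h2.symm
  have hli : LinearIndepOn ℂ w s := End.eigenvectors_linearIndependent' (R.L 0)
    (fun j : s => μ j) (hμ.comp Subtype.val_injective) _ fun j => j.2
  classical
  let r := (A.basis.repr a).filter (· ∈ s)
  have hr : Finsupp.linearCombination ℂ w r = 0 := by
    have h1 : Finsupp.linearCombination ℂ w (A.basis.repr a) = 0 := by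
      rw [← ha, gammaMap, Basis.constr_apply, Finsupp.linearCombination_apply]
    have h2 : Finsupp.linearCombination ℂ w ((A.basis.repr a).filter (· ∉ s)) = 0 := by
      rw [Finsupp.linearCombination_apply]
      refine Finset.sum_eq_zero fun j hj => ?_
      rw [Finsupp.support_filter, Finset.mem_filter, Finsupp.mem_support_iff] at hj
      have h3 : e (j.elim id id) = 0 := by
        by_contra h3
        exact hj.2 (hs j (mem_AOn.1 haS j hj.1) h3)
      have h4 : w j = 0 := by
        rcases j with k | k
        · exact h3
        · exact (congrArg R.ξ h3).trans (map_zero _)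
      change _ • w j = 0
      rw [h4, smul_zero]
    rw [← Finsupp.filter_add_filter_not (A.basis.repr a) (· ∈ s), map_add, h2, add_zero] at h1
    exact h1
  have h0 : r = 0 := linearIndepOn_iff.1 hli r
    ((Finsupp.mem_supported _ _).2 fun j hj => by
      rw [Finsupp.support_filter, Finset.mem_coe, Finset.mem_filter] at hj
      exact hj.2) hr
  have := DFunLike.congr_fun h0 i
  rwa [Finsupp.filter_apply_pos _ _ (hs i hi hi0)] at this

variable {p : JetPair} {I J : ℤ → Prop} {X : SuperModule p.ext.carrier M}

open JetPair in
/-- A family with the transformation behaviour of the `t^k` in `Γ(l, b)` defines a homomorphism. -/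
theorem gammaMap_hom (hp : p.IsSpanned I J) (hX : p.IsAssociative X) {S : ℤ → Prop} {l b : ℂ}
    {e : ℤ → M} (he : (hp.contactRep hX).IsGammaFamily S l b e) (x : p.ext.carrier) {a : A}
    (ha : a ∈ AOn S) : gammaMap (op X (0, ξ)) e (((Gamma l b).restrict p.ext).act x a) =
      X.act x (gammaMap (op X (0, ξ)) e a) := by
  have hop : X.act x = op X x.1 := (op_of_mem x.2).symm
  rw [hop]
  change gammaMap _ e (gammaK l b x.1.1 a + x.1.2 * a) = _
  have hspan : ∀ y : KA,
      (∀ k, S k → gammaMap (op X (0, ξ)) e (gammaK l b y.1 (t k) + y.2 * t k) = op X y (e k)) →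
      (∀ k, S k → gammaMap (op X (0, ξ)) e (gammaK l b y.1 (t k * ξ) + y.2 * (t k * ξ)) =
        op X y (op X (0, ξ) (e k))) →
      gammaMap (op X (0, ξ)) e (gammaK l b y.1 a + y.2 * a) =
        op X y (gammaMap (op X (0, ξ)) e a) := by
    intro y h1 h2
    refine Submodule.span_induction (p := fun a _ => gammaMap (op X (0, ξ)) e
      (gammaK l b y.1 a + y.2 * a) = op X y (gammaMap (op X (0, ξ)) e a)) ?_ ?_ ?_ ?_ ha
    · rintro _ (⟨k, hk, rfl⟩ | ⟨k, hk, rfl⟩)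
      · rw [gammaMap_t]; exact h1 k hk
      · rw [gammaMap_tξ]; exact h2 k hk
    · simp
    · intro y z _ _ h h'
      rw [map_add (gammaMap _ e) y z, map_add (op X _), ← h, ← h', ← map_add]
      congr 1
      rw [map_add, mul_add]
      abel
    · intro c y _ h
      rw [map_smul (gammaMap _ e) c y, map_smul (op X _), ← h, ← map_smul]
      congr 1
      rw [map_smul, mul_smul_comm, smul_add]
  let R := hp.contactRep hX
  refine hp.ext_induction (Q := fun x => gammaMap (op X (0, ξ)) e (gammaK l b x.1 a + x.2 * a) =
    op X x (gammaMap (op X (0, ξ)) e a)) (fun n hn => ?_) (fun n hn => ?_) (fun j hj => ?_)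
    (fun j hj => ?_) (fun x hx y hy h h' => ?_) (fun c x hx h => ?_) x.2
  · refine hspan _ (fun k hk => ?_) (fun k hk => ?_)
    · rw [zero_mul, add_zero, gammaK_L_t, map_smul, gammaMap_t]
      exact (he.L_e n k hn hk).symm
    · rw [zero_mul, add_zero, gammaK_L_tξ, map_smul, gammaMap_tξ]
      exact (R.L_ξ_of_L hn ((hp.self n hn).imp_right fun h => ⟨h, he.T_e n k h hk⟩)
        (he.L_e n k hn hk)).symm
  · refine hspan _ (fun k hk => ?_) (fun k hk => ?_)
    · rw [zero_mul, add_zero, gammaK_G_t, map_smul, gammaMap_tξ]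
      exact (he.G_e n k hn hk).symm
    · rw [zero_mul, add_zero, gammaK_G_tξ, map_neg, gammaMap_t]
      have h := R.G_ξ n hn (e k)
      rw [he.G_e n k hn hk, map_smul, R.ξ_ξ, he.T_e _ _ (hp.succ n hn) hk, smul_zero, neg_zero,
        zero_sub, add_right_comm] at h
      exact h.symm
  · refine hspan _ (fun k hk => ?_) (fun k hk => ?_)
    · rw [map_zero, LinearMap.zero_apply, zero_add, t_mul_t, gammaMap_t]
      exact (he.T_e j k hj hk).symm
    · rw [map_zero, LinearMap.zero_apply, zero_add, t_mul_tξ, gammaMap_tξ, ← he.T_e j k hj hk]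
      exact R.ξ_T j hj (e k)
  · refine hspan _ (fun k hk => ?_) (fun k hk => ?_)
    · rw [map_zero, LinearMap.zero_apply, zero_add, tξ_mul_t, gammaMap_tξ, ← he.T_e j k hj hk,
        hp.op_tξ hX hj]
      exact R.ξ_T j hj (e k)
    · rw [map_zero, LinearMap.zero_apply, zero_add, tξ_mul_tξ, map_zero, hp.op_tξ hX hj]
      exact ((congrArg (R.T j) (R.ξ_ξ (e k))).trans (map_zero _)).symm
  · rw [op_add hx hy, LinearMap.add_apply, ← h, ← h', ← map_add]
    congr 1
    rw [Prod.fst_add, Prod.snd_add, map_add, LinearMap.add_apply, add_mul]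
    abel
  · rw [op_smul, LinearMap.smul_apply, ← h, ← map_smul]
    congr 1
    rw [Prod.smul_fst, Prod.smul_snd, map_smul, LinearMap.smul_apply, smul_mul_assoc, smul_add]

end GammaMap

/-! ### Classification of the simple jet modules -/

namespace JetPair

variable {p : JetPair} {I J : ℤ → Prop} {M : Type u} [AddCommGroup M] [Module ℂ M]
  {X : SuperModule p.ext.carrier M}

theorem IsSpanned.exists_weight (hp : p.IsSpanned I J) (hI : I 0) (hX : p.IsJet X) :
    ∃ μ, ((hp.contactRep hX.isAssociative).L 0).eigenspace μ ≠ ⊥ ∧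
      FiniteDimensional ℂ (((hp.contactRep hX.isAssociative).L 0).eigenspace μ) := by
  obtain ⟨μ, h⟩ := hX.exists_finite
  have hL : (hp.contactRep hX.isAssociative).L 0 = X.act p.L_zero := op_of_mem (hp.L_mem hI)
  exact ⟨μ, by rw [hL]; exact h⟩

/-- A simple module containing a full chain of nonzero vectors is isomorphic to some `Γ(l, b)`. -/
theorem IsSpanned.isoUpToParity_Gamma (hp : p.IsSpanned I J) (hX : p.IsAssociative X)
    (hs : X.IsSimple) (hI : ∀ n, -1 ≤ n → I n) (hJ : ∀ k, 0 ≤ k → J k) {l b : ℂ} {e : ℤ → M}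
    {i : ZMod 2} (hmem : ∀ k, e k ∈ X.gr.part i) (hne : ∀ k, e k ≠ 0)
    (hchain : ((hp.contactRep hX).mono hI hJ).IsChain (fun _ => True) l b e)
    (he : (hp.contactRep hX).IsGammaFamily (fun _ => True) l b e) :
    X.IsoUpToParity ((Gamma l b).restrict p.ext) := by
  refine hs.isoUpToParity (gammaMap (op X (0, ξ)) e) i
    (gammaMap_mem (hp.contactRep hX).ξ_mem hmem)
    (fun x a => gammaMap_hom hp hX he x (mem_AOn.2 fun _ _ => trivial)) (fun a ha => ?_)
    ⟨t 0, by rw [gammaMap_t]; exact hne 0⟩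
  refine A.basis.repr.map_eq_zero_iff.1 (Finsupp.ext fun j => ?_)
  exact hchain.repr_eq_zero (mem_AOn.2 fun _ _ => trivial) ha j trivial (hne _)

end JetPair

open JetPair

/-- A simple jet module for `(𝔨, A)` need not be simple over `𝔨⁺`. Here the finite dimensional weight
space is used twice: for choosing the eigenvalue of `H`, and for controlling `L_n` with `n ≤ -2`. -/
theorem exists_iso_Gamma_of_pairKA {M : Type u} [AddCommGroup M] [Module ℂ M]
    (X : SuperModule pairKA.ext.carrier M) (hX : pairKA.IsJet X) (hs : X.IsSimple) :
    ∃ l b : ℂ, X.IsoUpToParity ((Gamma l b).restrict _) := by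
  have hp := isSpanned_pairKA
  let R := hp.contactRep hX.isAssociative
  obtain ⟨μ, h0, hfin⟩ := hp.exists_weight trivial hX
  obtain ⟨i, v, ν, b, hv, hno, hfin'⟩ :=
    R.toPlus.exists_isVacuum_of_invertible R.T_neg_T h0 hfin
  have hchain := hv.isChain_of_invertible fun j k => R.T_T j k trivial trivial
  rw [← sub_add_cancel ν b] at hno hfin'
  refine ⟨ν - b, b, hp.isoUpToParity_Gamma hX.isAssociative hs _ _
    (fun k => R.T_mem k i v hv.mem) (fun k h => hv.ne_zero ?_) hchain
    (R.isGammaFamily_of_toPlus hchain hno hfin')⟩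
  rw [← R.T_neg_T k v]
  exact (congrArg (R.T (-k)) h).trans (map_zero _)

theorem exists_iso_Gamma_of_pairKplusA {M : Type u} [AddCommGroup M] [Module ℂ M]
    (X : SuperModule pairKplusA.ext.carrier M) (hX : pairKplusA.IsJet X) (hs : X.IsSimple) :
    ∃ l b : ℂ, X.IsoUpToParity ((Gamma l b).restrict _) := by
  have hp := isSpanned_pairKplusA
  let R := hp.contactRep hX.isAssociative
  let R' : ContactRep (-1 ≤ ·) (0 ≤ ·) M := R.mono (fun _ h => h) fun _ _ => trivial
  have hTT : ∀ j k x, R.T j (R.T k x) = R.T (j + k) x := fun j k => R.T_T j k trivial trivial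
  have hT : ∀ k x, R.T (-k) (R.T k x) = x := fun k x => by
    rw [hTT, neg_add_cancel, R.T_zero]
  obtain ⟨μ, h0, hfin⟩ := hp.exists_weight (by omega) hX
  obtain ⟨i, v, ν, b, hv, hno, -⟩ := R'.exists_isVacuum_of_invertible hT h0 hfin
  have hchain := hv.isChain_of_invertible hTT
  rw [← sub_add_cancel ν b] at hno
  have hfam := hchain.isGammaFamily hno
  refine ⟨ν - b, b, hp.isoUpToParity_Gamma hX.isAssociative hs _ _
    (fun k => R.T_mem k i v hv.mem) (fun k h => hv.ne_zero ?_) hchain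
    ⟨fun j k _ _ => hTT j k v, hfam.L_e, hfam.G_e⟩⟩
  rw [← hT k v]
  exact (congrArg (R.T (-k)) h).trans (map_zero _)

theorem exists_iso_of_pairKplusAplus {M : Type u} [AddCommGroup M] [Module ℂ M]
    (X : SuperModule pairKplusAplus.ext.carrier M) (hX : pairKplusAplus.IsJet X)
    (hs : X.IsSimple) :
    (∃ l b : ℂ, (∀ n : ℤ, l ≠ n) ∧ X.IsoUpToParity ((Gamma l b).restrict _)) ∨
      (∃ b : ℂ, X.IsoUpToParity (GammaPlus b)) ∨ (∃ b : ℂ, X.IsoUpToParity (GammaMinus b)) := by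
  have hp := isSpanned_pairKplusAplus
  let R := hp.contactRep hX.isAssociative
  obtain ⟨μ, h0, hfin⟩ := hp.exists_weight (by omega) hX
  obtain ⟨i, v, ν, b, hv, hno⟩ := (hp.isIrreducible hX.isAssociative hs).exists_isVacuum h0 hfin
  have hker : ∀ a, a ∈ Subalgebra.toSubmodule Aplus ↔ a ∈ AOn (0 ≤ ·) := fun a => Iff.rfl
  rcases hv.exists_isChain_trichotomy with ⟨l, e, hl, hchain, hmem, hne⟩ |
    ⟨e, hchain, hmem, hne⟩ | ⟨e, hchain, hmem, hzero, hne⟩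
  · exact Or.inl ⟨l, b, hl, hp.isoUpToParity_Gamma hX.isAssociative hs (fun _ h => h)
      (fun _ h => h) hmem hne hchain (hchain.isGammaFamily (hno _))⟩
  · refine Or.inr (Or.inl ⟨b, ?_⟩)
    have hfam := hchain.isGammaFamily (hno _)
    refine hs.isoUpToParity (gammaMap R.ξ e ∘ₗ (Subalgebra.toSubmodule Aplus).subtype) i
      (fun j a ha => gammaMap_mem R.ξ_mem hmem j a.1 ha)
      (fun x a => gammaMap_hom hp hX.isAssociative hfam x ((hker a.1).1 a.2))
      (fun a ha => Subtype.ext ?_) ⟨⟨t 0, t_mem_Aplus le_rfl⟩, ?_⟩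
    · refine A.basis.repr.map_eq_zero_iff.1 (Finsupp.ext fun j => ?_)
      by_contra hj
      have hj0 := mem_AOn.1 ((hker a.1).1 a.2) j hj
      exact hj (hchain.repr_eq_zero ((hker a.1).1 a.2) ha j hj0 (hne _ hj0))
    · rw [LinearMap.comp_apply, Submodule.subtype_apply, gammaMap_t]
      exact hne 0 le_rfl
  · refine Or.inr (Or.inr ⟨b, ?_⟩)
    have hfam := hchain.isGammaFamily (hno _)
    have htriv : ∀ a, a ∈ AOn (fun _ => True) := fun a => mem_AOn.2 fun _ _ => trivial
    -- The chain vanishes in the places `k ≥ 0`, so that the homomorphism factors through `A / A⁺`.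
    have hle : Subalgebra.toSubmodule Aplus ≤ LinearMap.ker (gammaMap R.ξ e) := by
      refine Submodule.span_le.2 ?_
      rintro _ (⟨k, hk, rfl⟩ | ⟨k, hk, rfl⟩)
      · exact (gammaMap_t _ _ _).trans (hzero k hk)
      · refine (gammaMap_tξ _ _ _).trans ?_
        rw [hzero k hk, map_zero]
    refine hs.isoUpToParity ((Subalgebra.toSubmodule Aplus).liftQ (gammaMap R.ξ e) hle) i
      ?_ ?_ ?_ ⟨Submodule.Quotient.mk (t (-1)), ?_⟩
    · rintro j _ ⟨a, ha, rfl⟩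
      exact gammaMap_mem R.ξ_mem hmem j a ha
    · intro x a
      obtain ⟨a, rfl⟩ := Submodule.mkQ_surjective _ a
      exact gammaMap_hom hp hX.isAssociative hfam x (htriv a)
    · intro a ha
      obtain ⟨a, rfl⟩ := Submodule.mkQ_surjective _ a
      refine (Submodule.Quotient.mk_eq_zero _).2 ((hker a).2 (mem_AOn.2 fun j hj => ?_))
      by_contra hj0
      exact hj (hchain.repr_eq_zero (htriv a) ha j trivial (hne _ (not_le.1 hj0)))
    · rw [Submodule.liftQ_apply, gammaMap_t]
      exact hne (-1) (by omega)

end NeveuSchwarz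
end

theorem mainTheorem3 :
    (∀ (M : Type*) [AddCommGroup M] [Module ℂ M]
      (X : NeveuSchwarz.SuperModule NeveuSchwarz.pairKA.ext.carrier M),
      NeveuSchwarz.pairKA.IsJet X → X.IsSimple →
        ∃ l b : ℂ, X.IsoUpToParity ((NeveuSchwarz.Gamma l b).restrict _)) ∧
    (∀ (M : Type*) [AddCommGroup M] [Module ℂ M]
      (X : NeveuSchwarz.SuperModule NeveuSchwarz.pairKplusA.ext.carrier M),
      NeveuSchwarz.pairKplusA.IsJet X → X.IsSimple →
        ∃ l b : ℂ, X.IsoUpToParity ((NeveuSchwarz.Gamma l b).restrict _)) ∧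
    (∀ (M : Type*) [AddCommGroup M] [Module ℂ M]
      (X : NeveuSchwarz.SuperModule NeveuSchwarz.pairKplusAplus.ext.carrier M),
      NeveuSchwarz.pairKplusAplus.IsJet X → X.IsSimple →
        (∃ l b : ℂ, (∀ n : ℤ, l ≠ n) ∧ X.IsoUpToParity ((NeveuSchwarz.Gamma l b).restrict _)) ∨
        (∃ b : ℂ, X.IsoUpToParity (NeveuSchwarz.GammaPlus b)) ∨
        (∃ b : ℂ, X.IsoUpToParity (NeveuSchwarz.GammaMinus b))) :=
  ⟨fun _ _ _ X => NeveuSchwarz.exists_iso_Gamma_of_pairKA X,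
    fun _ _ _ X => NeveuSchwarz.exists_iso_Gamma_of_pairKplusA X,
    fun _ _ _ X => NeveuSchwarz.exists_iso_of_pairKplusAplus X⟩
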